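/- Let $\mathcal P=(\mathcal P(n))_n$ be a (linear, unital) non-symmetric operad over a field $\mathbb k$ with finite-dimensional components. Suppose that $\mathcal P$ is a quotient of the free non-symmetric operad $\mathcal F(\Upsilon)$ on a finite set $\Upsilon$ of generators of positive arities, in such a way that the kernel $C$ of $\mathcal F(\Upsilon)\to\mathcal P$ has a finite Gröbner basis. That is, for some order on the planar tree monomials which well-orders the monomials of each arity and for which partial compositions are strictly increasing in both arguments, there is a finite set $G$ of nonzero elements of $C$ such that the leading monomial of every nonzero element of $C$ is divisible by the leading monomial of an element of $G$ (a tree monomial $v$ is divisible by $w$ if $w$ is isomorphic to a planar subtree of $v$). Suppose that the sequence $\dim\mathcal P(n)$ has subexponential growth: for each real $d>1$ there is $C_d>0$ such that $\dim\mathcal P(n)<C_d\,d^{\,n}$ for all $n>0$. Then the generating series $$G_{\mathcal P}(z)=\sum_{n\ge1}\dim\mathcal P(n)\,z^n$$ is rational, i.e. $q\,G_{\mathcal P}=p$ for some polynomials $p,q\in\mathbb Q[z]$ with $q\neq0$. Moreover, either $\dim\mathcal P(n)=0$ for all sufficiently large $n$, or the dimensions have polynomial growth $[n^d]$ for some integer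 $d\ge0$, in the following sense: there are constants $c_-,c_+>0$ and integers $m,N_0$ such that $\dim\mathcal P(n)\le c_+n^d$ for all $n\ge1$, and for each $N\ge N_0$ at least one $n\in\{N,N+1,\dots,N+m-1\}$ satisfies $\dim\mathcal P(n)\ge c_-n^d$. -/

import Mathlib

open Polynomial

universe u v w w'

/-! ### Non-symmetric operads -/

/-- A (linear, unital) non-symmetric operad over `k`, presented by partial compositions.
`comp i hi h a b` is the operation obtained by inserting `b` into the `i`-th input of `a`; inputs
are counted from `0`, and the arity `l = m + n - 1` of the result is passed through
`h : m + n = l + 1`. -/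
structure NSOperad (k : Type u) [Field k] where
  obj : ℕ → Type w
  [addCommGroup : ∀ n, AddCommGroup (obj n)]
  [module : ∀ n, Module k (obj n)]
  one : obj 1
  comp : ∀ {m n l : ℕ} (i : ℕ), i < m → m + n = l + 1 → (obj m →ₗ[k] obj n →ₗ[k] obj l)
  one_comp : ∀ {n : ℕ} (h0 : 0 < 1) (h : 1 + n = n + 1) (b : obj n), comp 0 h0 h one b = b
  comp_one : ∀ {m : ℕ} (i : ℕ) (hi : i < m) (h : m + 1 = m + 1) (a : obj m),
    comp i hi h a one = a
  /-- sequential associativity -/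
  assoc_seq : ∀ {m n p q r s : ℕ} (i j ij : ℕ) (hi : i < m) (hj : j < n) (hij : ij < q)
    (_ : ij = i + j) (hq : m + n = q + 1) (hr : q + p = r + 1) (hs : n + p = s + 1)
    (hr' : m + s = r + 1) (a : obj m) (b : obj n) (c : obj p),
    comp ij hij hr (comp i hi hq a b) c = comp i hi hr' a (comp j hj hs b c)
  /-- parallel associativity -/
  assoc_par : ∀ {m n p q r s : ℕ} (i j j' : ℕ) (_ : i < j) (hi : i < m) (hj : j < m)
    (hj' : j' < q) (hi' : i < s) (_ : j' + 1 = j + n)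
    (hq : m + n = q + 1) (hr : q + p = r + 1) (hs : m + p = s + 1) (hr' : s + n = r + 1)
    (a : obj m) (b : obj n) (c : obj p),
    comp j' hj' hr (comp i hi hq a b) c = comp i hi' hr' (comp j hj hs a c) b

attribute [instance] NSOperad.addCommGroup NSOperad.module

/-- Morphisms of non-symmetric operads. -/
structure NSOperad.Hom {k : Type u} [Field k] (P : NSOperad.{u, w} k) (Q : NSOperad.{u, w'} k) where
  map : ∀ n, P.obj n →ₗ[k] Q.obj n
  map_one : map 1 P.one = Q.one
  map_comp : ∀ {m n l : ℕ} (i : ℕ) (hi : i < m) (h : m + n = l + 1) (a : P.obj m) (b : P.obj n),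
    map l (P.comp i hi h a b) = Q.comp i hi h (map m a) (map n b)

/-- A morphism that is onto in every arity. -/
def NSOperad.Hom.Surjective {k : Type u} [Field k] {P : NSOperad.{u, w} k}
    {Q : NSOperad.{u, w'} k} (φ : P.Hom Q) : Prop :=
  ∀ n, Function.Surjective (φ.map n)

/-! ### Planar tree monomials -/

/-- Planar rooted trees whose vertices are labelled by elements `x` of `Υ`, a vertex with the label
`x` having `ar x` ordered inputs. The tree `leaf` without vertices is the identity operation. -/
inductive PTree {Υ : Type v} (ar : Υ → ℕ) : Type v
  | leaf : PTree ar
  | node (x : Υ) (c : Fin (ar x) → PTree ar) : PTree ar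

namespace PTree

variable {Υ : Type v} {ar : Υ → ℕ}

/-- The number of leaves, that is, the arity of the monomial. -/
def leaves : PTree ar → ℕ
  | leaf => 1
  | node _ c => ∑ j, (c j).leaves

/-- The number of leaves to the left of the `j`-th branch. -/
def offset {n : ℕ} (c : Fin n → PTree ar) (j : Fin n) : ℕ :=
  ∑ j' ∈ Finset.Iio j, (c j').leaves

/-- `graft a i b` attaches the root of `b` to the `i`-th leaf of `a`, leaves being counted from the
left starting with `0` (and it is `a` if `a` has no such leaf). -/
def graft : PTree ar → ℕ → PTree ar → PTree ar
  | leaf, i, b => if i = 0 then b else leaf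
  | node x c, i, b =>
      node x fun j => if offset c j ≤ i then (c j).graft (i - offset c j) b else c j

/-- `LeftDvd w v`: the tree `w` is a planar subtree of `v` having the same root as `v`. -/
inductive LeftDvd : PTree ar → PTree ar → Prop
  | leaf (v : PTree ar) : LeftDvd PTree.leaf v
  | node (x : Υ) (c c' : Fin (ar x) → PTree ar) :
      (∀ j, LeftDvd (c j) (c' j)) → LeftDvd (PTree.node x c) (PTree.node x c')

/-- `Divides w v`: the monomial `v` is divisible by `w`, that is, some planar subtree of `v`
(with arbitrary root) is isomorphic to `w`. -/
inductive Divides (w : PTree ar) : PTree ar → Prop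
  | root (v : PTree ar) : LeftDvd w v → Divides w v
  | branch (x : Υ) (c : Fin (ar x) → PTree ar) (j : Fin (ar x)) :
      Divides w (c j) → Divides w (PTree.node x c)

theorem offset_add {n : ℕ} (c : Fin n → PTree ar) (j : Fin n) :
    offset c j + (c j).leaves = ∑ a ∈ insert j (Finset.Iio j), (c a).leaves := by
  rw [Finset.sum_insert (by simp), offset, add_comm]

theorem graft_of_le (a : PTree ar) : ∀ (i : ℕ) (b : PTree ar), a.leaves ≤ i → a.graft i b = a := by
  induction a with
  | leaf =>
    intro i b h
    have : i ≠ 0 := by simp only [leaves] at h; omega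
    simp [graft, this]
  | node x c ih =>
    intro i b h
    simp only [graft]
    congr 1
    funext j
    split_ifs with hj
    · apply ih
      have h1 : offset c j + (c j).leaves ≤ ∑ j, (c j).leaves := by
        rw [offset_add]
        exact Finset.sum_le_sum_of_subset (Finset.subset_univ _)
      simp only [leaves] at h
      omega
    · rfl

theorem offset_add_le {n : ℕ} (c : Fin n → PTree ar) {j j' : Fin n} (h : j < j') :
    offset c j + (c j).leaves ≤ offset c j' := by
  rw [offset_add, offset]
  refine Finset.sum_le_sum_of_subset fun a ha => ?_
  simp only [Finset.mem_insert, Finset.mem_Iio] at ha ⊢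
  rcases ha with rfl | ha
  · exact h
  · exact ha.trans h

theorem graft_node (x : Υ) (c : Fin (ar x) → PTree ar) (i : ℕ) (b : PTree ar) (j : Fin (ar x))
    (h1 : offset c j ≤ i) (h2 : i < offset c j + (c j).leaves) :
    (node x c).graft i b = node x (Function.update c j ((c j).graft (i - offset c j) b)) := by
  simp only [graft]
  congr 1
  funext j'
  rcases lt_trichotomy j' j with h | rfl | h
  · have := offset_add_le c h
    rw [Function.update_of_ne h.ne, if_pos (by omega)]
    exact graft_of_le _ _ _ (by omega)
  · simp [h1]
  · have := offset_add_le c h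
    rw [Function.update_of_ne h.ne', if_neg (by omega)]

theorem exists_branch {n : ℕ} (c : Fin n → PTree ar) (i : ℕ) (h : i < ∑ j, (c j).leaves) :
    ∃ j, offset c j ≤ i ∧ i < offset c j + (c j).leaves := by
  classical
  have hne : (Finset.univ.filter fun j => i < offset c j + (c j).leaves).Nonempty := by
    rcases n with _ | n
    · simp at h
    · refine ⟨Fin.last n, ?_⟩
      simp only [Finset.mem_filter, Finset.mem_univ, true_and]
      convert h using 1
      rw [offset_add]
      congr 1
      ext a
      simp only [Finset.mem_insert, Finset.mem_Iio, Finset.mem_univ, iff_true]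
      exact (Fin.le_last a).eq_or_lt
  set j := Finset.min' _ hne with hj
  have hmem := Finset.min'_mem _ hne
  rw [← hj] at hmem
  simp only [Finset.mem_filter, Finset.mem_univ, true_and] at hmem
  refine ⟨j, ?_, hmem⟩
  rcases Nat.eq_zero_or_pos j.val with h0 | h0
  · have : offset c j = 0 := by
      rw [offset]
      apply Finset.sum_eq_zero
      intro a ha
      have := Fin.lt_def.1 (Finset.mem_Iio.1 ha)
      omega
    omega
  · let p : Fin n := ⟨j.val - 1, by omega⟩
    have hp : p < j := by rw [Fin.lt_def]; simp only [p]; omega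
    have hpn : ¬ i < offset c p + (c p).leaves := by
      intro hlt
      have := Finset.min'_le (Finset.univ.filter fun j => i < offset c j + (c j).leaves) p
        (by simpa using hlt)
      exact absurd (hj ▸ this) (not_le.2 hp)
    have : offset c j = offset c p + (c p).leaves := by
      rw [offset_add, offset]
      congr 1
      ext a
      simp only [Finset.mem_insert, Finset.mem_Iio, Fin.lt_def, Fin.ext_iff, p]
      omega
    omega

theorem offset_update_of_le {n : ℕ} (c : Fin n → PTree ar) {j j' : Fin n} (t : PTree ar)
    (h : j' ≤ j) : offset (Function.update c j t) j' = offset c j' := by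
  refine Finset.sum_congr rfl fun a ha => ?_
  rw [Function.update_of_ne ((Finset.mem_Iio.1 ha).trans_le h).ne]

theorem offset_update_of_lt {n : ℕ} (c : Fin n → PTree ar) {j j' : Fin n} (t : PTree ar)
    (h : j < j') :
    offset (Function.update c j t) j' + (c j).leaves = offset c j' + t.leaves := by
  have hj : j ∈ Finset.Iio j' := Finset.mem_Iio.2 h
  rw [offset, offset, ← Finset.add_sum_erase _ _ hj, ← Finset.add_sum_erase _ _ hj]
  have : ∑ a ∈ (Finset.Iio j').erase j, (Function.update c j t a).leaves
      = ∑ a ∈ (Finset.Iio j').erase j, (c a).leaves :=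
    Finset.sum_congr rfl fun a ha => by rw [Function.update_of_ne (Finset.ne_of_mem_erase ha)]
  rw [this, Function.update_self]
  omega

theorem leaves_graft (a : PTree ar) : ∀ (i : ℕ) (b : PTree ar), i < a.leaves →
    a.leaves + b.leaves = (a.graft i b).leaves + 1 := by
  induction a with
  | leaf =>
    intro i b h
    have : i = 0 := by simp only [leaves] at h; omega
    simp [graft, this, leaves, add_comm]
  | node x c ih =>
    intro i b h
    obtain ⟨j, h1, h2⟩ := exists_branch c i h
    rw [graft_node x c i b j h1 h2]
    have := ih j (i - offset c j) b (by omega)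
    simp only [leaves]
    rw [← Finset.add_sum_erase _ _ (Finset.mem_univ j),
      ← Finset.add_sum_erase _ (fun j' => (Function.update c j _ j').leaves) (Finset.mem_univ j),
      Function.update_self]
    have h3 : ∀ t, ∑ a ∈ Finset.univ.erase j, (Function.update c j t a).leaves
        = ∑ a ∈ Finset.univ.erase j, (c a).leaves := fun t =>
      Finset.sum_congr rfl fun a ha => by rw [Function.update_of_ne (Finset.ne_of_mem_erase ha)]
    rw [h3]
    omega

theorem graft_leaf (a : PTree ar) : ∀ i, a.graft i leaf = a := by
  induction a with
  | leaf => intro i; simp [graft]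
  | node x c ih =>
    intro i
    simp only [graft]
    congr 1
    funext j
    split_ifs <;> simp [ih]

theorem graft_seq (a : PTree ar) : ∀ (i j : ℕ) (b c : PTree ar), i < a.leaves → j < b.leaves →
    (a.graft i b).graft (i + j) c = a.graft i (b.graft j c) := by
  induction a with
  | leaf =>
    intro i j b c hi hj
    have : i = 0 := by simp only [leaves] at hi; omega
    simp [graft, this]
  | node x d ih =>
    intro i j b c hi hj
    obtain ⟨o, h1, h2⟩ := exists_branch d i hi
    have hl := leaves_graft (d o) (i - offset d o) b (by omega)
    rw [graft_node x d i b o h1 h2, graft_node x d i _ o h1 h2,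
      graft_node x _ (i + j) c o (by rw [offset_update_of_le _ _ le_rfl]; omega)
        (by rw [offset_update_of_le _ _ le_rfl, Function.update_self]; omega),
      offset_update_of_le _ _ le_rfl, Function.update_self, Function.update_idem,
      show i + j - offset d o = i - offset d o + j by omega, ih o _ _ _ _ (by omega) hj]

theorem graft_par (a : PTree ar) : ∀ (i j j' : ℕ) (b c : PTree ar), i < j → j < a.leaves →
    j' + 1 = j + b.leaves → (a.graft i b).graft j' c = (a.graft j c).graft i b := by
  induction a with
  | leaf =>
    intro i j j' b c hi hj
    simp only [leaves] at hj
    omega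
  | node x d ih =>
    intro i j j' b c hij hj hj'
    obtain ⟨o, h1, h2⟩ := exists_branch d i (hij.trans hj)
    obtain ⟨o', h1', h2'⟩ := exists_branch d j hj
    have hl := leaves_graft (d o) (i - offset d o) b (by omega)
    have hl' := leaves_graft (d o') (j - offset d o') c (by omega)
    rcases lt_trichotomy o o' with h | rfl | h
    · have e1 := offset_update_of_lt d ((d o).graft (i - offset d o) b) h
      have e2 := offset_update_of_le d ((d o').graft (j - offset d o') c) h.le
      have e3 := offset_add_le d h
      rw [graft_node x d i b o h1 h2, graft_node x d j c o' h1' h2',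
        graft_node x _ j' c o' (by omega) (by rw [Function.update_of_ne h.ne']; omega),
        graft_node x _ i b o (by omega) (by rw [Function.update_of_ne h.ne]; omega),
        Function.update_of_ne h.ne', Function.update_of_ne h.ne, e2,
        Function.update_comm h.ne,
        show j' - offset (Function.update d o ((d o).graft (i - offset d o) b)) o'
          = j - offset d o' by omega]
    · rw [graft_node x d i b o h1 h2, graft_node x d j c o h1' h2',
        graft_node x _ j' c o (by rw [offset_update_of_le _ _ le_rfl]; omega)
          (by rw [offset_update_of_le _ _ le_rfl, Function.update_self]; omega),
        graft_node x _ i b o (by rw [offset_update_of_le _ _ le_rfl]; omega)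
          (by rw [offset_update_of_le _ _ le_rfl, Function.update_self]; omega),
        offset_update_of_le _ _ le_rfl, offset_update_of_le _ _ le_rfl, Function.update_self,
        Function.update_self, Function.update_idem, Function.update_idem,
        ih o (i - offset d o) (j - offset d o) (j' - offset d o) b c (by omega) (by omega)
          (by omega)]
    · have := offset_add_le d h
      omega

end PTree

/-- The set of planar tree monomials of arity `n`. -/
def TreeMonomial {Υ : Type v} (ar : Υ → ℕ) (n : ℕ) : Type v :=
  {t : PTree ar // t.leaves = n}

/-- Partial composition of tree monomials. -/
def TreeMonomial.comp {Υ : Type v} {ar : Υ → ℕ} {m n l : ℕ} (i : ℕ) (hi : i < m)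
    (h : m + n = l + 1) (a : TreeMonomial ar m) (b : TreeMonomial ar n) : TreeMonomial ar l :=
  ⟨a.1.graft i b.1, by
    have := PTree.leaves_graft a.1 i b.1 (by rw [a.2]; exact hi)
    rw [a.2, b.2] at this
    omega⟩

/-- The tree without vertices, as a monomial of arity one. -/
def TreeMonomial.leaf {Υ : Type v} (ar : Υ → ℕ) : TreeMonomial ar 1 :=
  ⟨PTree.leaf, by simp [PTree.leaves]⟩

/-! ### The free operad -/

/-- The bilinear extension of the partial composition of tree monomials. -/
noncomputable def freeComp (k : Type u) [Field k] {Υ : Type v} (ar : Υ → ℕ) {m n l : ℕ} (i : ℕ)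
    (hi : i < m) (h : m + n = l + 1) :
    (TreeMonomial ar m →₀ k) →ₗ[k] (TreeMonomial ar n →₀ k) →ₗ[k] (TreeMonomial ar l →₀ k) :=
  Finsupp.linearCombination k fun a => Finsupp.lmapDomain k k (TreeMonomial.comp i hi h a)

theorem freeComp_single (k : Type u) [Field k] {Υ : Type v} (ar : Υ → ℕ) {m n l : ℕ} (i : ℕ)
    (hi : i < m) (h : m + n = l + 1) (a : TreeMonomial ar m) (b : TreeMonomial ar n) (x y : k) :
    freeComp k ar i hi h (Finsupp.single a x) (Finsupp.single b y)
      = Finsupp.single (a.comp i hi h b) (x * y) := by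
  rw [freeComp, Finsupp.linearCombination_single, LinearMap.smul_apply, Finsupp.lmapDomain_apply,
    Finsupp.mapDomain_single, Finsupp.smul_single, smul_eq_mul]

/-- The free non-symmetric operad generated by `Υ`: its component of arity `n` has the tree
monomials of arity `n` as a basis, and these are composed by grafting. -/
noncomputable def freeNSOperad (k : Type u) [Field k] {Υ : Type v} (ar : Υ → ℕ) :
    NSOperad.{u, max u v} k where
  obj n := TreeMonomial ar n →₀ k
  one := Finsupp.single (TreeMonomial.leaf ar) 1
  comp i hi h := freeComp k ar i hi h
  one_comp h0 h b := by
    induction b using Finsupp.induction_linear with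
    | zero => rw [map_zero]
    | add f g hf hg => rw [map_add, hf, hg]
    | single s x =>
      have : TreeMonomial.comp 0 h0 h (TreeMonomial.leaf ar) s = s :=
        Subtype.ext (by simp [TreeMonomial.comp, TreeMonomial.leaf, PTree.graft])
      rw [freeComp_single, this, one_mul]
  comp_one i hi h a := by
    induction a using Finsupp.induction_linear with
    | zero => rw [map_zero, LinearMap.zero_apply]
    | add f g hf hg => rw [map_add, LinearMap.add_apply, hf, hg]
    | single s x =>
      have : TreeMonomial.comp i hi h s (TreeMonomial.leaf ar) = s :=
        Subtype.ext (PTree.graft_leaf _ _)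
      rw [freeComp_single, this, mul_one]
  assoc_seq i j ij hi hj hij e hq hr hs hr' a b c := by
    induction a using Finsupp.induction_linear with
    | zero => simp only [map_zero, LinearMap.zero_apply]
    | add f g hf hg => simp only [map_add, LinearMap.add_apply, hf, hg]
    | single s x =>
    induction b using Finsupp.induction_linear with
    | zero => simp only [map_zero, LinearMap.zero_apply]
    | add f g hf hg => simp only [map_add, LinearMap.add_apply, hf, hg]
    | single t y =>
    induction c using Finsupp.induction_linear with
    | zero => simp only [map_zero]
    | add f g hf hg => simp only [map_add, hf, hg]
    | single r z =>
      have : TreeMonomial.comp ij hij hr (TreeMonomial.comp i hi hq s t) r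
          = TreeMonomial.comp i hi hr' s (TreeMonomial.comp j hj hs t r) :=
        Subtype.ext (e ▸ PTree.graft_seq _ _ _ _ _ (by rw [s.2]; exact hi) (by rw [t.2]; exact hj))
      rw [freeComp_single, freeComp_single, freeComp_single, freeComp_single, this, mul_assoc]
  assoc_par i j j' hlt hi hj hj' hi' e hq hr hs hr' a b c := by
    induction a using Finsupp.induction_linear with
    | zero => simp only [map_zero, LinearMap.zero_apply]
    | add f g hf hg => simp only [map_add, LinearMap.add_apply, hf, hg]
    | single s x =>
    induction b using Finsupp.induction_linear with
    | zero => simp only [map_zero, LinearMap.zero_apply]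
    | add f g hf hg => simp only [map_add, LinearMap.add_apply, hf, hg]
    | single t y =>
    induction c using Finsupp.induction_linear with
    | zero => simp only [map_zero, LinearMap.zero_apply]
    | add f g hf hg => simp only [map_add, LinearMap.add_apply, hf, hg]
    | single r z =>
      have : TreeMonomial.comp j' hj' hr (TreeMonomial.comp i hi hq s t) r
          = TreeMonomial.comp i hi' hr' (TreeMonomial.comp j hj hs s r) t :=
        Subtype.ext (PTree.graft_par _ _ _ _ _ _ hlt (by rw [s.2]; exact hj) (by rw [t.2]; exact e))
      rw [freeComp_single, freeComp_single, freeComp_single, freeComp_single, this, mul_right_comm]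

/-! ### Gröbner bases -/

/-- An admissible order on tree monomials: a well-order on the monomials of each arity such that
partial compositions are strictly increasing in both arguments. -/
structure AdmissibleOrder {Υ : Type v} (ar : Υ → ℕ) where
  lt : ∀ n, TreeMonomial ar n → TreeMonomial ar n → Prop
  wellOrder : ∀ n, IsWellOrder (TreeMonomial ar n) (lt n)
  comp_left : ∀ {m n l : ℕ} (i : ℕ) (hi : i < m) (h : m + n = l + 1)
    (a a' : TreeMonomial ar m) (b : TreeMonomial ar n),
    lt m a a' → lt l (a.comp i hi h b) (a'.comp i hi h b)
  comp_right : ∀ {m n l : ℕ} (i : ℕ) (hi : i < m) (h : m + n = l + 1)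
    (a : TreeMonomial ar m) (b b' : TreeMonomial ar n),
    lt n b b' → lt l (a.comp i hi h b) (a.comp i hi h b')

/-- `t` is the leading monomial of the element `f` of the free operad. -/
def AdmissibleOrder.IsLeading {k : Type u} [Field k] {Υ : Type v} {ar : Υ → ℕ}
    (o : AdmissibleOrder ar) {n : ℕ} (f : (freeNSOperad k ar).obj n) (t : TreeMonomial ar n) :
    Prop :=
  (show TreeMonomial ar n →₀ k from f) t ≠ 0 ∧
    ∀ s, (show TreeMonomial ar n →₀ k from f) s ≠ 0 → s = t ∨ o.lt n s t

/-- `G` is a Gröbner basis, with respect to the order `o`, of the ideal of relations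
`n ↦ ker (φ.map n)` of the operad `P` presented as a quotient `φ` of a free operad: `G` consists of
nonzero elements of this ideal, and the leading monomial of every nonzero element of the ideal is
divisible by the leading monomial of an element of `G`. -/
def IsGroebnerBasis {k : Type u} [Field k] {Υ : Type v} {ar : Υ → ℕ} {P : NSOperad.{u, w} k}
    (φ : (freeNSOperad k ar).Hom P) (o : AdmissibleOrder ar)
    (G : Set (Σ n, (freeNSOperad k ar).obj n)) : Prop :=
  (∀ g ∈ G, g.2 ≠ 0 ∧ φ.map g.1 g.2 = 0) ∧
    ∀ (n : ℕ) (f : (freeNSOperad k ar).obj n) (t : TreeMonomial ar n),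
      φ.map n f = 0 → o.IsLeading f t →
        ∃ g ∈ G, ∃ s : TreeMonomial ar g.1, o.IsLeading g.2 s ∧ PTree.Divides s.1 t.1

/-- The non-symmetric operad `P` has a finite set of generators, all of positive arity, for which
its ideal of relations has a finite Gröbner basis. -/
def NSOperad.HasFiniteGroebnerBasis {k : Type u} [Field k] (P : NSOperad.{u, w} k) : Prop :=
  ∃ (Υ : Type) (_ : Finite Υ) (ar : Υ → ℕ) (_ : ∀ x, 1 ≤ ar x)
    (φ : (freeNSOperad k ar).Hom P) (o : AdmissibleOrder ar)
    (G : Set (Σ n, (freeNSOperad k ar).obj n)),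
    φ.Surjective ∧ G.Finite ∧ IsGroebnerBasis φ o G

/-! ### Generating series and growth -/

/-- The ordinary generating series of the dimensions of the components, `n ≥ 1`. -/
noncomputable def NSOperad.genSeries {k : Type u} [Field k] (P : NSOperad.{u, w} k) :
    PowerSeries ℚ :=
  PowerSeries.mk fun n => if n = 0 then 0 else (Module.finrank k (P.obj n) : ℚ)

/-- A formal power series is rational if it is a quotient of two polynomials. -/
def IsRationalSeries (f : PowerSeries ℚ) : Prop :=
  ∃ p q : ℚ[X], q ≠ 0 ∧ (q : PowerSeries ℚ) * f = (p : PowerSeries ℚ)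

/-- Subexponential growth of a sequence. -/
def SubexponentialGrowth (a : ℕ → ℝ) : Prop :=
  ∀ d : ℝ, 1 < d → ∃ C : ℝ, 0 < C ∧ ∀ n : ℕ, 0 < n → a n < C * d ^ n

/-- The sequence `a` grows like `n ^ d`: it is bounded above by a multiple of `n ^ d`, and there is
a window length `m` such that among any `m` consecutive large indices there is one at which `a` is
bounded below by a positive multiple of `n ^ d`. -/
def HasGrowth (a : ℕ → ℝ) (d : ℕ) : Prop :=
  (∃ C : ℝ, 0 < C ∧ ∀ n : ℕ, 0 < n → a n ≤ C * (n : ℝ) ^ d) ∧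
    ∃ c : ℝ, 0 < c ∧ ∃ m N₀ : ℕ, ∀ N : ℕ, N₀ ≤ N →
      ∃ n : ℕ, N ≤ n ∧ n < N + m ∧ c * (n : ℝ) ^ d ≤ a n

/-! The monomials that are not leading monomials of the kernel form a basis of the quotient. By the
Gröbner basis property they are the normal trees, those divisible by none of finitely many patterns,
so `dim P(n)` counts normal trees with `n` leaves (`NSOperad.card_normal`). Normality is recognized
by a finite bottom-up automaton: a tree has one of finitely many states, the state of a node depends
only on its label and the states of its branches (`PTree.state_node_congr`), and the state decides
normality.

Subexponential growth makes this automaton rigid. Let `A` be the set of trees of a state `p` of some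
normal tree. Two contexts that preserve `A` and have disjoint images on it would generate `2 ^ m`
trees of size linear in `m`, so their images meet (`PTree.SmallGrowth.exists_eq`). Comparing the
positions of the two holes shows that every nontrivial context preserving `A` factors through a
single smallest one, `K` (`PTree.SmallGrowth.exists_context`). Hence a tree of state `p` is uniquely
`K^[k] s`, where `s` has no proper subtree of state `p`.

Induction on the set of states allowed for proper subtrees now splits the normal trees into finitely
many families, each parametrized by tuples of natural numbers, with the number of leaves an affine
function of the tuple with positive linear coefficients (`PTree.SmallGrowth.isPolyParam`). A family
with constant term `a` and coefficients `b j` has generating series `z ^ a / ∏ (1 - z ^ b j)`, which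
is rational. The families with the largest number `D` of parameters determine the growth, of degree
`D - 1`; if `D = 0`, there are only finitely many normal trees. -/

/-! ### Contexts -/

namespace PTree

variable {Υ : Type v} {ar : Υ → ℕ}

/-- One-hole contexts, as functions that plug a tree into the hole. -/
inductive IsContext : (PTree ar → PTree ar) → Prop
  | hole : IsContext id
  | branch (x : Υ) (c : Fin (ar x) → PTree ar) (j : Fin (ar x)) (K : PTree ar → PTree ar) :
      IsContext K → IsContext fun t => PTree.node x (Function.update c j (K t))

theorem IsContext.comp {K L : PTree ar → PTree ar} (hK : IsContext K) (hL : IsContext L) :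
    IsContext (K ∘ L) := by
  induction hK with
  | hole => exact hL
  | branch x c j K _ ih => exact .branch x c j (K ∘ L) ih

theorem IsContext.iterate {K : PTree ar → PTree ar} (hK : IsContext K) (n : ℕ) :
    IsContext K^[n] := by
  induction n with
  | zero => exact .hole
  | succ n ih => rw [Function.iterate_succ]; exact ih.comp hK

theorem isContext_branch (x : Υ) (c : Fin (ar x) → PTree ar) (j : Fin (ar x)) :
    IsContext fun t => node x (Function.update c j t) :=
  .branch x c j _ .hole

/-- The number of vertices. -/
def vertices : PTree ar → ℕ
  | leaf => 0
  | node _ c => 1 + ∑ j, (c j).vertices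

theorem sum_update {n : ℕ} (f : PTree ar → ℕ) (c : Fin n → PTree ar) (j : Fin n) (t : PTree ar) :
    ∑ a, f (Function.update c j t a) = f t + ∑ a ∈ Finset.univ.erase j, f (c a) := by
  rw [← Finset.add_sum_erase _ _ (Finset.mem_univ j), Function.update_self]
  congr 1
  exact Finset.sum_congr rfl fun a ha => by rw [Function.update_of_ne (Finset.ne_of_mem_erase ha)]

theorem IsContext.leaves_eq {K : PTree ar → PTree ar} (hK : IsContext K) :
    ∃ e, ∀ t, (K t).leaves = t.leaves + e := by
  induction hK with
  | hole => exact ⟨0, fun _ => rfl⟩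
  | branch x c j K _ ih =>
    obtain ⟨e, he⟩ := ih
    refine ⟨e + ∑ a ∈ Finset.univ.erase j, (c a).leaves, fun t => ?_⟩
    rw [leaves, sum_update leaves, he, add_assoc]

/-- Unlike leaves, vertices detect nontrivial contexts: a unary vertex adds no leaf. They therefore
serve as the measure for minimality and for inductions. -/
theorem IsContext.vertices_eq {K : PTree ar → PTree ar} (hK : IsContext K) :
    ∃ e, (e = 0 → K = id) ∧ ∀ t, (K t).vertices = t.vertices + e := by
  induction hK with
  | hole => exact ⟨0, fun _ => rfl, fun _ => rfl⟩
  | branch x c j K _ ih =>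
    obtain ⟨e, -, he⟩ := ih
    refine ⟨1 + e + ∑ a ∈ Finset.univ.erase j, (c a).vertices, by omega, fun t => ?_⟩
    rw [vertices, sum_update vertices, he]
    omega

theorem IsContext.vertices_lt {K : PTree ar → PTree ar} (hK : IsContext K) (h : K ≠ id)
    (t : PTree ar) : t.vertices < (K t).vertices := by
  obtain ⟨e, h0, he⟩ := hK.vertices_eq
  have := mt h0 h
  have := he t
  omega

theorem update_right_injective {n : ℕ} {c : Fin n → PTree ar} {j : Fin n} {s t : PTree ar}
    (h : Function.update c j s = Function.update c j t) : s = t := by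
  simpa using congr_fun h j

theorem IsContext.injective {K : PTree ar → PTree ar} (hK : IsContext K) :
    Function.Injective K := by
  induction hK with
  | hole => exact Function.injective_id
  | branch x c j K _ ih =>
    intro s t h
    simp only [PTree.node.injEq, heq_eq_eq, true_and] at h
    exact ih (update_right_injective h)

/-- If a tree is obtained by plugging `u` into `K` and also by plugging `u'` into `K'`, then one
of the two holes lies above the other or they are disjoint. -/
theorem IsContext.overlap {K : PTree ar → PTree ar} (hK : IsContext K) :
    ∀ {K' : PTree ar → PTree ar}, IsContext K' → ∀ {u u' : PTree ar}, K u = K' u' →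
      (∃ M, IsContext M ∧ K' = K ∘ M) ∨ (∃ M, IsContext M ∧ K = K' ∘ M) ∨
      ∃ C : PTree ar → PTree ar → PTree ar, (∀ t, IsContext fun s => C s t) ∧
        (∀ s, IsContext (C s) ∧ C s ≠ id) ∧
        (K = fun s => C s u') ∧ K' = C u ∧ (∀ s t s' t', C s t = C s' t' → s = s' ∧ t = t') := by
  induction hK with
  | hole => exact fun {K'} hK' _ _ _ => .inl ⟨K', hK', rfl⟩
  | branch x c j K hK ih =>
    intro K' hK' u u' h
    cases hK' with
    | hole => exact .inr (.inl ⟨_, .branch x c j K hK, rfl⟩)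
    | branch x' c' j' K' hK' =>
      simp only [PTree.node.injEq] at h
      obtain ⟨rfl, h⟩ := h
      rw [heq_eq_eq] at h
      by_cases hj : j = j'
      · subst hj
        have h1 : K u = K' u' := by simpa using congr_fun h j
        have h2 : ∀ t, Function.update c' j t = Function.update c j t := by
          intro t
          funext a
          by_cases ha : a = j
          · subst ha; simp
          · simpa [ha] using (congr_fun h a).symm
        rcases ih hK' h1 with ⟨M, hM, rfl⟩ | ⟨M, hM, rfl⟩ | ⟨C, hC, hC', rfl, rfl, hinj⟩
        · exact .inl ⟨M, hM, by funext t; simp [h2]⟩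
        · exact .inr (.inl ⟨M, hM, by funext t; simp [h2]⟩)
        · refine .inr (.inr ⟨fun s t => node x (Function.update c j (C s t)),
            fun t => .branch x c j _ (hC t),
            fun s => ⟨.branch x c j _ (hC' s).1, fun e => ?_⟩, rfl,
            by funext t; exact congr_arg _ (h2 _), fun s t s' t' e => ?_⟩)
          · exact absurd (congr_fun e leaf) (by simp)
          simp only [PTree.node.injEq, heq_eq_eq, true_and] at e
          exact hinj _ _ _ _ (update_right_injective e)
      -- The holes lie in different branches: `C` has both holes open, and fixing either argument
      -- recovers `K` or `K'`.
      · have h1 : c j' = K' u' := by simpa [Ne.symm hj] using congr_fun h j'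
        refine .inr (.inr
          ⟨fun s t => node x (Function.update (Function.update c j' (K' t)) j (K s)),
            fun t => .branch x _ j _ hK, fun s => ⟨?_, ?_⟩, ?_, ?_, fun s t s' t' e => ?_⟩)
        · simp only [Function.update_comm (Ne.symm hj)]
          exact .branch x _ j' _ hK'
        · exact fun e => absurd (congr_fun e leaf) (by simp)
        · funext t
          simp only [← h1, Function.update_eq_self]
        · funext t
          congr 1
          rw [Function.update_comm (Ne.symm hj), h, Function.update_idem]
        · simp only [PTree.node.injEq, heq_eq_eq, true_and] at e
          refine ⟨hK.injective (by simpa using congr_fun e j), hK'.injective ?_⟩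
          simpa [Ne.symm hj] using congr_fun e j'

/-! ### Contexts, grafting and divisibility. -/

theorem IsContext.exists_graft {K : PTree ar → PTree ar} (hK : IsContext K) :
    ∃ (a : PTree ar) (i : ℕ), i < a.leaves ∧ ∀ t, K t = a.graft i t := by
  induction hK with
  | hole => exact ⟨leaf, 0, by simp [leaves], fun t => by simp [graft]⟩
  | branch x c j K _ ih =>
    obtain ⟨a, i, hi, h⟩ := ih
    have ho := offset_update_of_le c a (le_refl j)
    refine ⟨node x (Function.update c j a), offset c j + i, ?_, fun t => ?_⟩
    · rw [leaves, sum_update leaves, offset]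
      have : ∑ b ∈ Finset.Iio j, (c b).leaves ≤ ∑ b ∈ Finset.univ.erase j, (c b).leaves :=
        Finset.sum_le_sum_of_subset fun b hb => by
          simpa using (Finset.mem_Iio.1 hb).ne
      omega
    · rw [graft_node _ _ _ _ j (by omega) (by rw [Function.update_self]; omega),
        Function.update_self, Function.update_idem, ho, Nat.add_sub_cancel_left, ← h]

/-- A set closed under grafting onto leaves is closed under multiples with the same root, also
inside of a context. -/
theorem context_mem_of_leftDvd {L : Set (PTree ar)}
    (hL : ∀ a ∈ L, ∀ i < a.leaves, ∀ b, a.graft i b ∈ L) {s t : PTree ar} (h : LeftDvd s t) :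
    ∀ K, IsContext K → K s ∈ L → K t ∈ L := by
  induction h with
  | leaf v =>
    intro K hK hs
    obtain ⟨a, i, hi, h⟩ := hK.exists_graft
    have h1 : K leaf = a := by rw [h, graft_leaf]
    rw [h]
    exact hL _ (h1 ▸ hs) _ hi _
  | node x c c' _ ih =>
    intro K hK hs
    -- The branches are replaced one at a time; each replacement is `ih` inside the context formed
    -- by `K` and the other branches, which is why `K` is arbitrary in the statement.
    have key : ∀ F : Finset (Fin (ar x)), K (node x fun j => if j ∈ F then c' j else c j) ∈ L := by
      intro F
      induction F using Finset.induction_on with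
      | empty => simpa using hs
      | insert j F hj ih' =>
        let d : Fin (ar x) → PTree ar := fun j => if j ∈ F then c' j else c j
        have h1 : Function.update d j (c j) = fun j => if j ∈ F then c' j else c j := by
          rw [Function.update_eq_iff]; simp [d, hj]
        have h2 : Function.update d j (c' j) = fun a => if a ∈ insert j F then c' a else c a := by
          funext a
          by_cases ha : a = j
          · subst ha; simp
          · simp [ha, d]
        rw [← h2]
        refine ih j (K ∘ fun t => node x (Function.update d j t))
          (hK.comp (isContext_branch x d j)) ?_
        simpa [h1] using ih'
    simpa using key Finset.univ

theorem Divides.exists_context {w v : PTree ar} (h : Divides w v) :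
    ∃ K t, IsContext K ∧ LeftDvd w t ∧ v = K t := by
  induction h with
  | root v h => exact ⟨_, v, .hole, h, rfl⟩
  | branch x c j _ ih =>
    obtain ⟨K, t, hK, ht, h⟩ := ih
    exact ⟨_, t, .branch x c j K hK, ht, by rw [← h, Function.update_eq_self]⟩

/-- A set of trees that is closed under grafting on both sides is closed under multiples. -/
theorem Divides.mem {L : Set (PTree ar)}
    (hr : ∀ a ∈ L, ∀ i < a.leaves, ∀ b, a.graft i b ∈ L)
    (hl : ∀ b ∈ L, ∀ a : PTree ar, ∀ i < a.leaves, a.graft i b ∈ L)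
    {s t : PTree ar} (h : Divides s t) (hs : s ∈ L) : t ∈ L := by
  obtain ⟨K, s', hK, hs', rfl⟩ := h.exists_context
  obtain ⟨a, i, hi, h⟩ := hK.exists_graft
  rw [h]
  exact hl _ (context_mem_of_leftDvd hr hs' _ .hole hs) _ _ hi

end PTree

/-! ### Normal monomials -/

namespace AdmissibleOrder

variable {k : Type u} [Field k] {Υ : Type v} {ar : Υ → ℕ}

/-- A strictly increasing map on a total order is injective. -/
theorem comp_injective_left (o : AdmissibleOrder ar) {m n l : ℕ} (i : ℕ) (hi : i < m)
    (h : m + n = l + 1)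
    (b : TreeMonomial ar n) :
    Function.Injective fun a : TreeMonomial ar m => a.comp i hi h b := by
  have := o.wellOrder m
  have := o.wellOrder l
  intro a a' e
  rcases trichotomous_of (o.lt m) a a' with h1 | h1 | h1
  · have h2 := o.comp_left i hi h _ _ b h1
    simp only at e
    rw [e] at h2
    exact absurd h2 (irrefl_of (o.lt l) _)
  · exact h1
  · have h2 := o.comp_left i hi h _ _ b h1
    simp only at e
    rw [e] at h2
    exact absurd h2 (irrefl_of (o.lt l) _)

theorem comp_injective_right (o : AdmissibleOrder ar) {m n l : ℕ} (i : ℕ) (hi : i < m)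
    (h : m + n = l + 1)
    (a : TreeMonomial ar m) :
    Function.Injective fun b : TreeMonomial ar n => a.comp i hi h b := by
  have := o.wellOrder n
  have := o.wellOrder l
  intro b b' e
  rcases trichotomous_of (o.lt n) b b' with h1 | h1 | h1
  · have h2 := o.comp_right i hi h a _ _ h1
    simp only at e
    rw [e] at h2
    exact absurd h2 (irrefl_of (o.lt l) _)
  · exact h1
  · have h2 := o.comp_right i hi h a _ _ h1
    simp only at e
    rw [e] at h2
    exact absurd h2 (irrefl_of (o.lt l) _)

theorem IsLeading.mapDomain {o : AdmissibleOrder ar} {m n : ℕ} {f : TreeMonomial ar m →₀ k}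
    {t : TreeMonomial ar m} (h : o.IsLeading (k := k) f t)
    (g : TreeMonomial ar m → TreeMonomial ar n) (hg : Function.Injective g)
    (hlt : ∀ a b, o.lt m a b → o.lt n (g a) (g b)) :
    o.IsLeading (k := k) (n := n) (Finsupp.mapDomain g f : TreeMonomial ar n →₀ k) (g t) := by
  classical
  refine ⟨?_, fun s hs => ?_⟩
  · change (Finsupp.mapDomain g f) (g t) ≠ 0
    rw [Finsupp.mapDomain_apply hg]
    exact h.1
  · have := Finsupp.mapDomain_support (Finsupp.mem_support_iff.2 hs)
    obtain ⟨a, ha, rfl⟩ := Finset.mem_image.1 this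
    rcases h.2 a (Finsupp.mem_support_iff.1 ha) with rfl | h1
    · exact .inl rfl
    · exact .inr (hlt _ _ h1)

theorem exists_isLeading (o : AdmissibleOrder ar) {n : ℕ} (f : TreeMonomial ar n →₀ k)
    (hf : f ≠ 0) :
    ∃ t, o.IsLeading (k := k) f t := by
  classical
  have := o.wellOrder n
  let := linearOrderOfSTO (o.lt n)
  have hne : f.support.Nonempty := Finsupp.support_nonempty_iff.2 hf
  refine ⟨f.support.max' hne, Finsupp.mem_support_iff.1 (f.support.max'_mem hne), fun s hs => ?_⟩
  exact (f.support.le_max' s (Finsupp.mem_support_iff.2 hs)).eq_or_lt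

end AdmissibleOrder

theorem freeComp_single_right {k : Type u} [Field k] {Υ : Type v} {ar : Υ → ℕ} {m n l : ℕ} (i : ℕ)
    (hi : i < m) (h : m + n = l + 1) (f : TreeMonomial ar m →₀ k) (b : TreeMonomial ar n) :
    freeComp k ar i hi h f (Finsupp.single b 1)
      = Finsupp.mapDomain (fun a => a.comp i hi h b) f := by
  induction f using Finsupp.induction_linear with
  | zero => simp
  | add f g hf hg => rw [map_add, LinearMap.add_apply, hf, hg, Finsupp.mapDomain_add]
  | single s x => rw [freeComp_single, Finsupp.mapDomain_single, mul_one]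

theorem freeComp_single_left {k : Type u} [Field k] {Υ : Type v} {ar : Υ → ℕ} {m n l : ℕ} (i : ℕ)
    (hi : i < m) (h : m + n = l + 1) (a : TreeMonomial ar m) (f : TreeMonomial ar n →₀ k) :
    freeComp k ar i hi h (Finsupp.single a 1) f
      = Finsupp.mapDomain (fun b => a.comp i hi h b) f := by
  rw [freeComp, Finsupp.linearCombination_single, one_smul, Finsupp.lmapDomain_apply]

/-! ### Leading monomials of the kernel. -/

section Kernel

variable {k : Type u} [Field k] {Υ : Type v} {ar : Υ → ℕ} {P : NSOperad.{u, w} k}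
  (φ : (freeNSOperad k ar).Hom P) (o : AdmissibleOrder ar)

/-- The trees that are leading monomials of elements of the kernel of `φ`. -/
def leadingTrees : Set (PTree ar) :=
  {t | ∃ f : (freeNSOperad k ar).obj t.leaves, φ.map _ f = 0 ∧ o.IsLeading f ⟨t, rfl⟩}

theorem mem_leadingTrees {n : ℕ} {t : TreeMonomial ar n} :
    t.1 ∈ leadingTrees φ o ↔
      ∃ f : (freeNSOperad k ar).obj n, φ.map n f = 0 ∧ o.IsLeading f t := by
  obtain ⟨t, rfl⟩ := t
  rfl

/-- The kernel is an ideal, and composition with a monomial is injective and increasing on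
monomials, so it carries leading monomials to leading monomials. -/
theorem leadingTrees_comp_right {m n l : ℕ} (i : ℕ) (hi : i < m) (h : m + n = l + 1)
    (a : TreeMonomial ar m) (b : TreeMonomial ar n) (ha : a.1 ∈ leadingTrees φ o) :
    (a.comp i hi h b).1 ∈ leadingTrees φ o := by
  obtain ⟨f, hf, hl⟩ := (mem_leadingTrees φ o).1 ha
  let b' : (freeNSOperad k ar).obj n := Finsupp.single b (1 : k)
  refine (mem_leadingTrees φ o).2 ⟨(freeNSOperad k ar).comp i hi h f b', ?_, ?_⟩
  · rw [φ.map_comp, hf, map_zero, LinearMap.zero_apply]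
  · have : (freeNSOperad k ar).comp i hi h f b'
        = Finsupp.mapDomain (fun a => TreeMonomial.comp i hi h a b) f :=
      freeComp_single_right i hi h f b
    rw [this]
    exact hl.mapDomain _ (o.comp_injective_left i hi h _) fun _ _ h1 => o.comp_left i hi h _ _ _ h1

theorem leadingTrees_comp_left {m n l : ℕ} (i : ℕ) (hi : i < m) (h : m + n = l + 1)
    (a : TreeMonomial ar m) (b : TreeMonomial ar n) (hb : b.1 ∈ leadingTrees φ o) :
    (a.comp i hi h b).1 ∈ leadingTrees φ o := by
  obtain ⟨f, hf, hl⟩ := (mem_leadingTrees φ o).1 hb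
  let a' : (freeNSOperad k ar).obj m := Finsupp.single a (1 : k)
  refine (mem_leadingTrees φ o).2 ⟨(freeNSOperad k ar).comp i hi h a' f, ?_, ?_⟩
  · rw [φ.map_comp, hf, map_zero]
  · have : (freeNSOperad k ar).comp i hi h a' f
        = Finsupp.mapDomain (fun b => TreeMonomial.comp i hi h a b) f :=
      freeComp_single_left i hi h a f
    rw [this]
    exact hl.mapDomain _ (o.comp_injective_right i hi h _)
      fun _ _ h1 => o.comp_right i hi h _ _ _ h1

/-- The monomials that are not leading monomials of the kernel form a basis of the quotient. -/
theorem card_not_mem_leadingTrees (hφ : φ.Surjective) (n : ℕ) [FiniteDimensional k (P.obj n)] :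
    Finite {t : TreeMonomial ar n // t.1 ∉ leadingTrees φ o} ∧
      Nat.card {t : TreeMonomial ar n // t.1 ∉ leadingTrees φ o} = Module.finrank k (P.obj n) := by
  classical
  have hwo := o.wellOrder n
  let ψ : (TreeMonomial ar n →₀ k) →ₗ[k] P.obj n := φ.map n
  let b : {t : TreeMonomial ar n // t.1 ∉ leadingTrees φ o} → P.obj n :=
    fun t => ψ (Finsupp.single t.1 1)
  have hb : ∀ f, Finsupp.linearCombination k b f = ψ (Finsupp.mapDomain Subtype.val f) := by
    intro f
    induction f using Finsupp.induction_linear with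
    | zero => simp
    | add f g hf hg => rw [map_add, hf, hg, Finsupp.mapDomain_add, map_add]
    | single s x =>
      rw [Finsupp.linearCombination_single, Finsupp.mapDomain_single, ← map_smul,
        Finsupp.smul_single, smul_eq_mul, mul_one]
  -- A relation among these monomials is an element of the kernel, whose leading monomial would be
  -- one of them.
  have hli : LinearIndependent k b := by
    rw [linearIndependent_iff]
    intro f hf
    rw [hb] at hf
    by_contra hne
    have hne' : Finsupp.mapDomain Subtype.val f ≠ 0 := fun h0 =>
      hne (Finsupp.mapDomain_injective Subtype.val_injective (by rw [h0, Finsupp.mapDomain_zero]))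
    obtain ⟨t, ht⟩ := o.exists_isLeading _ hne'
    have h1 := Finsupp.mapDomain_support (Finsupp.mem_support_iff.2 ht.1)
    obtain ⟨a, -, rfl⟩ := Finset.mem_image.1 h1
    exact a.2 ((mem_leadingTrees φ o).2 ⟨_, hf, ht⟩)
  -- Reduction along the well-order: modulo the kernel, a leading monomial is a combination of
  -- smaller monomials.
  have hsp : ∀ t, ψ (Finsupp.single t 1) ∈ Submodule.span k (Set.range b) := by
    intro t
    induction t using (IsWellFounded.wf (r := o.lt n)).induction with
    | _ t ih =>
    by_cases ht : t.1 ∈ leadingTrees φ o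
    · obtain ⟨f, hf, hl⟩ := (mem_leadingTrees φ o).1 ht
      let f' : TreeMonomial ar n →₀ k := f
      have h0 : ψ f' = 0 := hf
      have hsum : f' = Finsupp.single t (f' t) + f'.erase t := (Finsupp.single_add_erase t f').symm
      have h1 : ψ (f'.erase t) ∈ Submodule.span k (Set.range b) := by
        rw [← Finsupp.sum_single (f'.erase t), Finsupp.sum, map_sum]
        refine Submodule.sum_mem _ fun s hs => ?_
        have hs' := Finsupp.mem_support_iff.1 hs
        have hst : s ≠ t := by rintro rfl; simp at hs'
        rw [Finsupp.erase_ne hst] at hs'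
        have := ih s ((hl.2 s hs').resolve_left hst)
        rw [← mul_one ((f'.erase t) s), ← smul_eq_mul, ← Finsupp.smul_single, map_smul]
        exact Submodule.smul_mem _ _ this
      have h2 : f' t • ψ (Finsupp.single t 1) = - ψ (f'.erase t) := by
        rw [eq_neg_iff_add_eq_zero, ← map_smul, Finsupp.smul_single, smul_eq_mul, mul_one,
          ← map_add, ← hsum, h0]
      have h3 : f' t ≠ 0 := hl.1
      rw [← inv_smul_smul₀ h3 (ψ (Finsupp.single t 1)), h2]
      exact Submodule.smul_mem _ _ (Submodule.neg_mem _ h1)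
    · exact Submodule.subset_span ⟨⟨t, ht⟩, rfl⟩
  have htop : ⊤ ≤ Submodule.span k (Set.range b) := by
    intro y _
    obtain ⟨f, rfl⟩ := hφ n y
    change ψ (show TreeMonomial ar n →₀ k from f) ∈ _
    generalize (show TreeMonomial ar n →₀ k from f) = f
    induction f using Finsupp.induction_linear with
    | zero => simp
    | add f g hf hg => rw [map_add]; exact Submodule.add_mem _ hf hg
    | single s x =>
      rw [← mul_one x, ← smul_eq_mul, ← Finsupp.smul_single, map_smul]
      exact Submodule.smul_mem _ _ (hsp s)
  let B := Module.Basis.mk hli htop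
  have hfin : Finite {t : TreeMonomial ar n // t.1 ∉ leadingTrees φ o} :=
    Module.Finite.finite_basis B
  exact ⟨hfin, (Module.finrank_eq_nat_card_basis B).symm⟩

/-- The leading monomials of the elements of `G`. -/
def leadingPatterns (G : Set (Σ n, (freeNSOperad k ar).obj n)) : Set (PTree ar) :=
  {w | ∃ g ∈ G, ∃ s : TreeMonomial ar g.1, o.IsLeading g.2 s ∧ s.1 = w}

theorem leadingPatterns_finite {G : Set (Σ n, (freeNSOperad k ar).obj n)} (hG : G.Finite) :
    (leadingPatterns o G).Finite := by
  have : leadingPatterns o G =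
      ⋃ g ∈ G, {w | ∃ s : TreeMonomial ar g.1, o.IsLeading g.2 s ∧ s.1 = w} := by
    ext w
    simp only [leadingPatterns, Set.mem_ofPred_eq, Set.mem_iUnion, exists_prop]
  rw [this]
  refine hG.biUnion fun g _ => Set.Finite.subset
    ((show TreeMonomial ar g.1 →₀ k from g.2).support.finite_toSet.image Subtype.val) ?_
  rintro w ⟨s, hs, rfl⟩
  exact ⟨s, Finsupp.mem_support_iff.2 hs.1, rfl⟩

theorem mem_leadingTrees_iff_divides {G : Set (Σ n, (freeNSOperad k ar).obj n)}
    (hG : IsGroebnerBasis φ o G) (t : PTree ar) :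
    t ∈ leadingTrees φ o ↔ ∃ w ∈ leadingPatterns o G, PTree.Divides w t := by
  constructor
  · rintro ⟨f, hf, hl⟩
    obtain ⟨g, hg, s, hs, hd⟩ := hG.2 _ f _ hf hl
    exact ⟨s.1, ⟨g, hg, s, hs, rfl⟩, hd⟩
  · rintro ⟨_, ⟨g, hg, s, hs, rfl⟩, hd⟩
    exact hd.mem
      (fun a ha i hi b =>
        leadingTrees_comp_right φ o i hi (PTree.leaves_graft a i b hi) ⟨a, rfl⟩ ⟨b, rfl⟩ ha)
      (fun b hb a i hi =>
        leadingTrees_comp_left φ o i hi (PTree.leaves_graft a i b hi) ⟨a, rfl⟩ ⟨b, rfl⟩ hb)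
      ((mem_leadingTrees φ o).2 ⟨g.2, (hG.1 g hg).2, hs⟩)

end Kernel

/-! ### States of trees -/

namespace PTree

variable {Υ : Type v} {ar : Υ → ℕ}

theorem leaves_pos (har : ∀ x, 1 ≤ ar x) (t : PTree ar) : 0 < t.leaves := by
  induction t with
  | leaf => simp [leaves]
  | node x c ih =>
    exact Finset.sum_pos (fun j _ => ih j) ⟨⟨0, har x⟩, Finset.mem_univ _⟩

/-- The full subtrees of a tree. -/
def subtrees : PTree ar → Set (PTree ar)
  | leaf => {leaf}
  | node x c => insert (node x c) (⋃ j, (c j).subtrees)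

theorem subtrees_finite (t : PTree ar) : t.subtrees.Finite := by
  induction t with
  | leaf => exact Set.finite_singleton _
  | node x c ih => exact (Set.finite_iUnion ih).insert _

theorem self_mem_subtrees (t : PTree ar) : t ∈ t.subtrees := by
  cases t <;> simp [subtrees]

theorem branch_mem_subtrees {w : PTree ar} {x : Υ} {c : Fin (ar x) → PTree ar} (j : Fin (ar x)) :
    node x c ∈ w.subtrees → c j ∈ w.subtrees := by
  induction w with
  | leaf => simp [subtrees]
  | node y d ih =>
    simp only [subtrees, Set.mem_insert_iff, Set.mem_iUnion]
    rintro (h | ⟨i, h⟩)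
    · simp only [PTree.node.injEq] at h
      obtain ⟨rfl, h⟩ := h
      obtain rfl := eq_of_heq h
      exact .inr ⟨j, self_mem_subtrees _⟩
    · exact .inr ⟨i, ih i h⟩

/-- A tree is normal with respect to `W` if it is not divisible by an element of `W`. -/
def Normal (W : Set (PTree ar)) (t : PTree ar) : Prop :=
  ∀ w ∈ W, ¬ Divides w t

theorem Normal.branch {W : Set (PTree ar)} {x : Υ} {c : Fin (ar x) → PTree ar}
    (h : Normal W (node x c)) (j : Fin (ar x)) : Normal W (c j) :=
  fun w hw hd => h w hw (.branch x c j hd)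

theorem leftDvd_node_iff {w : PTree ar} {x : Υ} {c : Fin (ar x) → PTree ar} :
    LeftDvd w (node x c) ↔
      w = leaf ∨ ∃ d : Fin (ar x) → PTree ar, w = node x d ∧ ∀ j, LeftDvd (d j) (c j) := by
  constructor
  · intro h
    cases h with
    | leaf => exact .inl rfl
    | node _ d _ h => exact .inr ⟨d, rfl, h⟩
  · rintro (rfl | ⟨d, rfl, h⟩)
    · exact .leaf _
    · exact .node _ _ _ h

theorem divides_node_iff {w : PTree ar} {x : Υ} {c : Fin (ar x) → PTree ar} :
    Divides w (node x c) ↔ LeftDvd w (node x c) ∨ ∃ j, Divides w (c j) := by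
  constructor
  · intro h
    cases h with
    | root _ h => exact .inl h
    | branch _ _ j h => exact .inr ⟨j, h⟩
  · rintro (h | ⟨j, h⟩)
    · exact .root _ h
    · exact .branch _ _ j h

/-- The state of a tree: the subtrees of elements of `W` that divide it at the root, and whether
it is normal. -/
def state (W : Set (PTree ar)) (t : PTree ar) : Set (⋃ w ∈ W, subtrees w : Set (PTree ar)) × Prop :=
  ({w | LeftDvd w.1 t}, Normal W t)

theorem normal_iff_of_state_eq {W : Set (PTree ar)} {s t : PTree ar} (h : state W s = state W t) :
    Normal W s ↔ Normal W t :=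
  iff_of_eq (congr_arg Prod.snd h)

theorem leftDvd_iff_of_state_eq {W : Set (PTree ar)} {s t : PTree ar} (h : state W s = state W t)
    {w : PTree ar} (hw : w ∈ ⋃ w ∈ W, subtrees w) : LeftDvd w s ↔ LeftDvd w t :=
  iff_of_eq (congr_fun (congr_arg Prod.fst h) ⟨w, hw⟩)

/-- Whether a pattern with root `x` matches at the root depends on whether its branches match at the
roots of the branches of the tree. These smaller patterns are again subtrees of elements of `W`, so
the states of the branches record them. Normality of the node then means that no pattern matches at
the root and that all branches are normal. -/
theorem state_node_congr (W : Set (PTree ar)) (x : Υ) (c c' : Fin (ar x) → PTree ar)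
    (h : ∀ j, state W (c j) = state W (c' j)) : state W (node x c) = state W (node x c') := by
  have h1 : ∀ w ∈ ⋃ w ∈ W, subtrees w, LeftDvd w (node x c) ↔ LeftDvd w (node x c') := by
    intro w hw
    rw [leftDvd_node_iff, leftDvd_node_iff]
    refine or_congr_right (exists_congr fun d => and_congr_right ?_)
    rintro rfl
    refine forall_congr' fun j => leftDvd_iff_of_state_eq (h j) ?_
    simp only [Set.mem_iUnion] at hw ⊢
    obtain ⟨v, hv, hw⟩ := hw
    exact ⟨v, hv, branch_mem_subtrees j hw⟩
  refine Prod.ext (Set.ext fun w => h1 w.1 w.2) (propext ?_)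
  have h2 : ∀ c : Fin (ar x) → PTree ar, Normal W (node x c) ↔
      (∀ w ∈ W, ¬ LeftDvd w (node x c)) ∧ ∀ j, Normal W (c j) := by
    intro c
    simp only [Normal, divides_node_iff, not_or, not_exists]
    exact ⟨fun h => ⟨fun w hw => (h w hw).1, fun j w hw => (h w hw).2 j⟩,
      fun h w hw => ⟨h.1 w hw, fun j => h.2 j w hw⟩⟩
  change Normal W _ ↔ Normal W _
  rw [h2, h2]
  refine and_congr (forall₂_congr fun w hw => not_congr (h1 w ?_))
    (forall_congr' fun j => normal_iff_of_state_eq (h j))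
  exact Set.mem_biUnion hw (self_mem_subtrees w)

theorem finite_state {W : Set (PTree ar)} (hW : W.Finite) :
    Finite (Set (⋃ w ∈ W, subtrees w : Set (PTree ar)) × Prop) := by
  have : Finite (⋃ w ∈ W, subtrees w : Set (PTree ar)) :=
    (hW.biUnion fun w _ => subtrees_finite w).to_subtype
  infer_instance

/-- A congruence on trees is respected by contexts. -/
theorem IsContext.congr {Q : Type*} {st : PTree ar → Q}
    (hst : ∀ x (c c' : Fin (ar x) → PTree ar), (∀ j, st (c j) = st (c' j)) →
      st (node x c) = st (node x c'))
    {K : PTree ar → PTree ar} (hK : IsContext K) {s t : PTree ar} (h : st s = st t) :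
    st (K s) = st (K t) := by
  induction hK with
  | hole => exact h
  | branch x c j K _ ih =>
    refine hst _ _ _ fun a => ?_
    by_cases ha : a = j
    · subst ha; simpa using ih
    · simp [ha]

/-! ### Growth and contexts -/

/-- A set of trees with finitely many trees in each arity and subexponential growth. -/
def SmallGrowth (A : Set (PTree ar)) : Prop :=
  (∀ n, {t ∈ A | t.leaves = n}.Finite) ∧
    SubexponentialGrowth fun n => ({t ∈ A | t.leaves = n}.ncard : ℝ)

theorem SmallGrowth.mono {A B : Set (PTree ar)} (hB : SmallGrowth B) (h : A ⊆ B) :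
    SmallGrowth A := by
  have h1 : ∀ n, {t ∈ A | t.leaves = n} ⊆ {t ∈ B | t.leaves = n} := fun n t ht => ⟨h ht.1, ht.2⟩
  refine ⟨fun n => (hB.1 n).subset (h1 n), fun d hd => ?_⟩
  obtain ⟨C, hC, hlt⟩ := hB.2 d hd
  refine ⟨C, hC, fun n hn => lt_of_le_of_lt ?_ (hlt n hn)⟩
  exact Nat.cast_le.2 (Set.ncard_le_ncard (h1 n) (hB.1 n))

/-- Two contexts acting on a set of small growth cannot have disjoint images. -/
theorem SmallGrowth.exists_eq (har : ∀ x, 1 ≤ ar x) {A : Set (PTree ar)} (hA : SmallGrowth A)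
    (hne : A.Nonempty) {K L : PTree ar → PTree ar} (hK : IsContext K) (hL : IsContext L)
    (hKA : ∀ t ∈ A, K t ∈ A) (hLA : ∀ t ∈ A, L t ∈ A) :
    ∃ s ∈ A, ∃ t ∈ A, K s = L t := by
  classical
  by_contra! hcon
  obtain ⟨t₀, ht₀⟩ := hne
  obtain ⟨e, he⟩ := hK.leaves_eq
  obtain ⟨f, hf⟩ := hL.leaves_eq
  -- The words of length `m` in `K ∘ L` and `L ∘ K` are applied to `t₀`. Both letters add `e + f`
  -- leaves, and disjointness of the images of `K` and `L` makes the resulting trees distinct.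
  have key : ∀ m : ℕ, ∃ B : Finset (PTree ar), B.card = 2 ^ m ∧
      ∀ t ∈ B, t ∈ A ∧ t.leaves = t₀.leaves + (e + f) * m := by
    intro m
    induction m with
    | zero => exact ⟨{t₀}, by simp, by simpa using ht₀⟩
    | succ m ih =>
      obtain ⟨B, hcard, hB⟩ := ih
      refine ⟨B.image (K ∘ L) ∪ B.image (L ∘ K), ?_, ?_⟩
      · rw [Finset.card_union_of_disjoint, Finset.card_image_of_injective _ (hK.comp hL).injective,
          Finset.card_image_of_injective _ (hL.comp hK).injective, hcard, pow_succ]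
        · ring
        · rw [Finset.disjoint_left]
          intro t h1 h2
          obtain ⟨a, ha, rfl⟩ := Finset.mem_image.1 h1
          obtain ⟨b, hb, h⟩ := Finset.mem_image.1 h2
          exact hcon _ (hLA _ (hB a ha).1) _ (hKA _ (hB b hb).1) h.symm
      · intro t ht
        rcases Finset.mem_union.1 ht with ht | ht <;> obtain ⟨a, ha, rfl⟩ := Finset.mem_image.1 ht
        · refine ⟨hKA _ (hLA _ (hB a ha).1), ?_⟩
          rw [Function.comp_apply, he, hf, (hB a ha).2]
          ring
        · refine ⟨hLA _ (hKA _ (hB a ha).1), ?_⟩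
          rw [Function.comp_apply, hf, he, (hB a ha).2]
          ring
  set r := e + f
  -- A base with `d ^ r ≤ 3 / 2 < 2`, which the `2 ^ m` trees outgrow; `r + 1` avoids a zero
  -- denominator.
  let d : ℝ := (3 / 2 : ℝ) ^ ((1 : ℝ) / (r + 1 : ℕ))
  have hd : 1 < d := Real.one_lt_rpow (by norm_num) (by positivity)
  have hdr : d ^ r ≤ 3 / 2 := by
    have : d ^ (r + 1) = 3 / 2 := by
      rw [← Real.rpow_natCast, ← Real.rpow_mul (by norm_num), one_div_mul_cancel (by positivity),
        Real.rpow_one]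
    rw [← this]
    exact pow_le_pow_right₀ hd.le (Nat.le_succ r)
  obtain ⟨C, hC, hlt⟩ := hA.2 d hd
  have hbound : ∀ m : ℕ, (2 : ℝ) ^ m < C * d ^ t₀.leaves * (3 / 2) ^ m := by
    intro m
    obtain ⟨B, hcard, hB⟩ := key m
    have h1 := hlt (t₀.leaves + r * m) (by have := leaves_pos har t₀; omega)
    have h2 : B.card ≤ {t ∈ A | t.leaves = t₀.leaves + r * m}.ncard := by
      rw [← Set.ncard_coe_finset]
      exact Set.ncard_le_ncard (fun t ht => hB t ht) (hA.1 _)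
    have h3 : (2 : ℝ) ^ m ≤ ({t ∈ A | t.leaves = t₀.leaves + r * m}.ncard : ℝ) := by
      rw [hcard] at h2
      exact_mod_cast h2
    refine (h3.trans_lt h1).trans_le ?_
    rw [pow_add, pow_mul, ← mul_assoc]
    gcongr
  obtain ⟨m, hm⟩ := pow_unbounded_of_one_lt (C * d ^ t₀.leaves) (show (1 : ℝ) < 4 / 3 by norm_num)
  have h1 := hbound m
  have h2 : (2 : ℝ) ^ m = (4 / 3) ^ m * (3 / 2) ^ m := by rw [← mul_pow]; norm_num
  rw [h2] at h1
  exact absurd (lt_of_mul_lt_mul_right h1 (by positivity)) (not_lt.2 hm.le)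

/-- In a set of small growth given by a state, there is at most one elementary nontrivial context
acting on it, and all others factor through it. -/
theorem SmallGrowth.exists_context (har : ∀ x, 1 ≤ ar x) {Q : Type*} {st : PTree ar → Q}
    (hst : ∀ x (c c' : Fin (ar x) → PTree ar), (∀ j, st (c j) = st (c' j)) →
      st (node x c) = st (node x c'))
    {p : Q} (hA : SmallGrowth {t | st t = p})
    (hex : ∃ K t, IsContext K ∧ K ≠ id ∧ st t = p ∧ st (K t) = p) :
    ∃ K : PTree ar → PTree ar, IsContext K ∧ K ≠ id ∧ (∀ t, st t = p → st (K t) = p) ∧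
      ∀ L t, IsContext L → L ≠ id → st t = p → st (L t) = p →
        ∃ M, IsContext M ∧ L = K ∘ M ∧ st (M t) = p := by
  classical
  obtain ⟨K₀, t₀, hK₀, hne₀, ht₀, hKt₀⟩ := hex
  have maps : ∀ {K}, IsContext K → ∀ {t}, st t = p → st (K t) = p → ∀ s, st s = p → st (K s) = p :=
    fun hK t ht hKt s hs => (hK.congr hst (hs.trans ht.symm)).trans hKt
  -- `K` is chosen with the fewest vertices among the nontrivial contexts preserving the state `p`.
  let X : ℕ → Prop := fun e => ∃ K, IsContext K ∧ K ≠ id ∧ (∀ t, st t = p → st (K t) = p) ∧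
    ∀ t, (K t).vertices = t.vertices + e
  have hX : ∃ e, X e := by
    obtain ⟨e, -, he⟩ := hK₀.vertices_eq
    exact ⟨e, K₀, hK₀, hne₀, maps hK₀ ht₀ hKt₀, he⟩
  obtain ⟨K, hK, hne, hKp, hKe⟩ := Nat.find_spec hX
  refine ⟨K, hK, hne, hKp, fun L t hL hLne ht hLt => ?_⟩
  have hLp := maps hL ht hLt
  obtain ⟨s, hs, s', hs', hss⟩ := hA.exists_eq har ⟨t, ht⟩ hK hL hKp hLp
  rcases hK.overlap hL hss with ⟨M, hM, rfl⟩ | ⟨M, hM, hKL⟩ | ⟨C, hC, hC', hKC, -, hCinj⟩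
  · have : M s' = s := (hK.injective hss).symm
    exact ⟨M, hM, rfl, maps hM hs' (by rw [this]; exact hs) t ht⟩
  -- If `K` factors through `L`, minimality forces `K = L`.
  · obtain ⟨e, -, he⟩ := hL.vertices_eq
    obtain ⟨e', h0, he'⟩ := hM.vertices_eq
    have h1 := Nat.find_min' hX ⟨L, hL, hLne, hLp, he⟩
    have h2 := hKe t
    rw [hKL, Function.comp_apply, he, he'] at h2
    have : M = id := h0 (by omega)
    subst this
    exact ⟨id, .hole, hKL.symm, ht⟩
  -- If the holes are disjoint, `K` is `C` with `s'` in its second hole. Putting `K s'` there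
  -- instead gives another context preserving `p`. The images of the two meet, and injectivity of
  -- `C` yields `s' = K s'`, contradicting the vertex count.
  · exfalso
    have hu : st (K s') = p := hKp _ hs'
    have hKs : ∀ t, K t = C t s' := fun t => congr_fun hKC t
    have hC2 : ∀ t, st t = p → st (C t (K s')) = p := fun t ht =>
      ((hC' t).1.congr hst (hu.trans hs'.symm)).trans (hKs t ▸ hKp t ht)
    obtain ⟨a, -, b, -, hab⟩ := hA.exists_eq har ⟨t, ht⟩ hK (hC (K s')) hKp hC2
    have h1 := (hCinj _ _ _ _ ((hKs a).symm.trans hab)).2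
    have h2 := hK.vertices_lt hne s'
    rw [← h1] at h2
    exact lt_irrefl _ h2

end PTree

/-! ### Polynomially parametrized weights -/

/-- A weight `w` on a type `X` is polynomially parametrized if `X` is a finite disjoint union of
sets of tuples of natural numbers on which `w` is given by affine functions with positive
linear coefficients. -/
def IsPolyParam {X : Type} (w : X → ℕ) : Prop :=
  ∃ (ι : Type) (_ : Finite ι) (δ : ι → Type) (_ : ∀ i, Fintype (δ i)) (a : ι → ℕ)
    (b : ∀ i, δ i → ℕ) (e : (Σ i, (δ i → ℕ)) ≃ X),
    (∀ i j, 0 < b i j) ∧ ∀ i k, w (e ⟨i, k⟩) = a i + ∑ j, b i j * k j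

namespace IsPolyParam

theorem of_equiv {X Y : Type} {v : X → ℕ} {w : Y → ℕ} (hv : IsPolyParam v) (f : X ≃ Y)
    (h : ∀ x, w (f x) = v x) : IsPolyParam w := by
  obtain ⟨ι, hι, δ, hδ, a, b, e, hb, he⟩ := hv
  exact ⟨ι, hι, δ, hδ, a, b, e.trans f, hb, fun i k => by rw [Equiv.trans_apply, h, he]⟩

theorem of_subsingleton {X : Type} [Subsingleton X] (w : X → ℕ) : IsPolyParam w := by
  rcases isEmpty_or_nonempty X with h | ⟨⟨x⟩⟩
  · exact ⟨Empty, inferInstance, fun _ => Empty, fun _ => inferInstance, fun _ => 0, fun _ _ => 1,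
      Equiv.equivOfIsEmpty _ _, fun i => i.elim, fun i => i.elim⟩
  · let e : (Σ _ : Unit, (Empty → ℕ)) ≃ X :=
      { toFun := fun _ => x
        invFun := fun _ => ⟨(), fun j => j.elim⟩
        left_inv := fun p => Sigma.ext rfl (heq_of_eq (funext fun j => j.elim))
        right_inv := fun y => Subsingleton.elim _ _ }
    exact ⟨Unit, inferInstance, fun _ => Empty, fun _ => inferInstance, fun _ => w x,
      fun _ _ => 1, e, fun _ j => j.elim, fun _ _ => by simp [e]⟩

theorem sigma {κ : Type} [Finite κ] {X : κ → Type} {w : ∀ k, X k → ℕ}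
    (h : ∀ k, IsPolyParam (w k)) : IsPolyParam fun x : Σ k, X k => w x.1 x.2 := by
  choose ι hι δ hδ a b e hb he using h
  refine ⟨Σ k, ι k, inferInstance, fun p => δ p.1 p.2, fun p => hδ p.1 p.2, fun p => a p.1 p.2,
    fun p => b p.1 p.2, (Equiv.sigmaAssoc fun k i => (δ k i → ℕ)).trans (Equiv.sigmaCongrRight e),
    fun p => hb p.1 p.2, fun p k => ?_⟩
  exact he p.1 p.2 k

theorem of_fibers {X κ : Type} [Finite κ] {w : X → ℕ} (g : X → κ)
    (h : ∀ k, IsPolyParam fun x : {x // g x = k} => w x.1) : IsPolyParam w :=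
  (sigma h).of_equiv (Equiv.sigmaFiberEquiv g) fun _ => rfl

/-- Affine functions of separate variables add up to an affine function of the disjoint union of the
variables. -/
theorem pi {κ : Type} [Fintype κ] {X : κ → Type} {w : ∀ k, X k → ℕ}
    (h : ∀ k, IsPolyParam (w k)) : IsPolyParam fun x : ∀ k, X k => ∑ k, w k (x k) := by
  choose ι hι δ hδ a b e hb he using h
  let f : (Σ f : ∀ k, ι k, ((Σ k, δ k (f k)) → ℕ)) ≃ ∀ k, Σ i, (δ k i → ℕ) :=
    { toFun := fun p k => ⟨p.1 k, fun j => p.2 ⟨k, j⟩⟩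
      invFun := fun h => ⟨fun k => (h k).1, fun j => (h j.1).2 j.2⟩
      left_inv := fun _ => rfl
      right_inv := fun _ => rfl }
  refine ⟨∀ k, ι k, inferInstance, fun f => Σ k, δ k (f k), fun f => inferInstance,
    fun f => ∑ k, a k (f k), fun f j => b j.1 (f j.1) j.2, f.trans (Equiv.piCongrRight e),
    fun f j => hb _ _ _, fun p k => ?_⟩
  rw [Fintype.sum_sigma, ← Finset.sum_add_distrib]
  exact Finset.sum_congr rfl fun j _ => he j _ _

theorem prod_nat {X : Type} {w : X → ℕ} (h : IsPolyParam w) {c : ℕ} (hc : 0 < c) :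
    IsPolyParam fun x : X × ℕ => w x.1 + c * x.2 := by
  obtain ⟨ι, hι, δ, hδ, a, b, e, hb, he⟩ := h
  let f : (Σ i, (Option (δ i) → ℕ)) ≃ (Σ i, (δ i → ℕ)) × ℕ :=
    { toFun := fun p => (⟨p.1, fun j => p.2 (some j)⟩, p.2 none)
      invFun := fun q => ⟨q.1.1, fun j => j.elim q.2 q.1.2⟩
      left_inv := by
        rintro ⟨i, k⟩
        simp only [Sigma.mk.injEq, heq_eq_eq, true_and]
        funext j
        cases j <;> rfl
      right_inv := fun _ => rfl }
  refine ⟨ι, hι, fun i => Option (δ i), fun i => inferInstance, a, fun i j => j.elim c (b i),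
    f.trans (Equiv.prodCongr e (Equiv.refl ℕ)), ?_, fun i k => ?_⟩
  · rintro i (_ | j)
    · exact hc
    · exact hb i j
  · rw [Fintype.sum_option]
    have : w (e ⟨i, fun j => k (some j)⟩) = a i + ∑ j, b i j * k (some j) := he _ _
    change w (e ⟨i, fun j => k (some j)⟩) + c * k none
      = a i + (c * k none + ∑ j, b i j * k (some j))
    rw [this]
    ring

end IsPolyParam

/-! ### Trees with prescribed states of proper subtrees -/

namespace PTree

variable {Υ : Type} {ar : Υ → ℕ} {Q : Type} (st : PTree ar → Q)

/-- The trees of state `p` all of whose proper subtrees have a state in `S`. -/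
def treesOver (p : Q) (S : Finset Q) : Set (PTree ar) :=
  {t | st t = p ∧ ∀ K s, IsContext K → K ≠ id → t = K s → st s ∈ S}

variable {st}

theorem IsContext.comp_ne_id {K L : PTree ar → PTree ar} (hK : IsContext K) (hL : IsContext L)
    (h : K ≠ id ∨ L ≠ id) : K ∘ L ≠ id := by
  intro e
  obtain ⟨a, ha, ha'⟩ := hK.vertices_eq
  obtain ⟨b, hb, hb'⟩ := hL.vertices_eq
  have h1 : (K (L leaf)).vertices = (leaf : PTree ar).vertices := by
    rw [← Function.comp_apply (f := K), e, id]
  rw [ha', hb'] at h1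
  rcases h with h | h
  · exact h (ha (by omega))
  · exact h (hb (by omega))

theorem treesOver_of_context {p q : Q} {S : Finset Q} {K : PTree ar → PTree ar} {s : PTree ar}
    (hK : IsContext K) (ht : K s ∈ treesOver st p S) (hs : st s = q) : s ∈ treesOver st q S := by
  refine ⟨hs, fun L r hL hne hr => ht.2 (K ∘ L) r (hK.comp hL) (hK.comp_ne_id hL (.inr hne)) ?_⟩
  rw [hr, Function.comp_apply]

theorem treesOver_mono {p : Q} {S T : Finset Q} (h : S ⊆ T) :
    treesOver st p S ⊆ treesOver st p T :=
  fun _ ht => ⟨ht.1, fun K s hK hne e => h (ht.2 K s hK hne e)⟩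

theorem IsContext.iterate_ne_id {K : PTree ar → PTree ar} (hK : IsContext K) (hne : K ≠ id)
    {m : ℕ} (hm : m ≠ 0) : K^[m] ≠ id := by
  obtain ⟨m, rfl⟩ := Nat.exists_eq_succ_of_ne_zero hm
  rw [Function.iterate_succ]
  exact (hK.iterate m).comp_ne_id hK (.inr hne)

/-- Otherwise the iterates `K^[k] u` would be infinitely many trees of one arity, distinct by their
vertex counts. With unary generators this needs the finiteness in `SmallGrowth`. -/
theorem leaves_pos_of_context {A : Set (PTree ar)} (hA : SmallGrowth A)
    {K : PTree ar → PTree ar} (hK : IsContext K) (hne : K ≠ id) {u : PTree ar}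
    (hu : ∀ k, K^[k] u ∈ A) {e : ℕ} (he : ∀ t, (K t).leaves = t.leaves + e) : 0 < e := by
  by_contra h0
  obtain rfl : e = 0 := by omega
  have hinj : Function.Injective fun k => K^[k] u := by
    refine Function.Injective.of_comp (f := vertices)
      (strictMono_nat_of_lt_succ fun k => ?_).injective
    simp only [Function.comp_apply, Function.iterate_succ_apply']
    exact hK.vertices_lt hne _
  refine Set.infinite_of_injective_forall_mem hinj (fun k => ?_) (hA.1 u.leaves)
  refine ⟨hu k, ?_⟩
  induction k with
  | zero => rfl
  | succ k ih => rw [Function.iterate_succ_apply', he, ih, add_zero]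

variable (har : ∀ x, 1 ≤ ar x)
  (hst : ∀ x (c c' : Fin (ar x) → PTree ar), (∀ j, st (c j) = st (c' j)) →
    st (node x c) = st (node x c'))

include hst in
/-- A context that occurs at the root of a tree with proper subtrees in `S` acts on such trees. -/
theorem context_mem_treesOver {p : Q} {S : Finset Q} (hp : p ∈ S) {K : PTree ar → PTree ar}
    (hK : IsContext K) {u : PTree ar} (hu : st u = p)
    (hKu : K u ∈ treesOver st p S) {s : PTree ar} (hs : s ∈ treesOver st p S) :
    K s ∈ treesOver st p S := by
  refine ⟨(hK.congr hst (hs.1.trans hu.symm)).trans hKu.1, fun L r hL hne e => ?_⟩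
  -- The subtree `r` lies inside `s` (possibly equal to it, hence `p ∈ S`), or contains `s` and has
  -- the state of the corresponding subtree of `K u`, or is disjoint from `s` and occurs in `K u`
  -- already.
  rcases hK.overlap hL e with ⟨M, hM, rfl⟩ | ⟨M, hM, rfl⟩ | ⟨C, hC, hC', hKC, hLC, -⟩
  · have hr : s = M r := hK.injective e
    by_cases h1 : M = id
    · subst h1
      rw [← show s = r from hr, hs.1]
      exact hp
    · exact hs.2 M r hM h1 hr
  · have hr : M s = r := hL.injective e
    rw [← hr, hM.congr hst (hs.1.trans hu.symm)]
    exact hKu.2 L (M u) hL hne rfl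
  · exact hKu.2 (C u) r (hC' u).1 (hC' u).2 (congr_fun hKC u)

-- Every tree in question is uniquely `K^[k] s` with `s` free of proper subtrees of state `p`, where
-- `K` is the smallest context preserving `p`. The exponent `k` is one new parameter, with the
-- number of leaves added by `K` as its coefficient.
include har hst in
theorem isPolyParam_treesOver_of_mem {p : Q} {S : Finset Q} [DecidableEq Q] (hp : p ∈ S)
    (hA : SmallGrowth {t | st t = p})
    (ih : IsPolyParam fun t : treesOver st p (S.erase p) => t.1.leaves) :
    IsPolyParam fun t : treesOver st p S => t.1.leaves := by
  by_cases hex : ∃ K s, IsContext K ∧ K ≠ id ∧ st s = p ∧ K s ∈ treesOver st p S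
  · obtain ⟨K₁, s₁, hK₁, hne₁, hs₁, ht₁⟩ := hex
    obtain ⟨K, hK, hne, -, hfac⟩ := hA.exists_context har hst ⟨K₁, s₁, hK₁, hne₁, hs₁, ht₁.1⟩
    -- The given tree is `K` applied to `M₁ s₁`, of state `p`, so `context_mem_treesOver` applies to
    -- `K` itself.
    obtain ⟨M₁, -, rfl, hu⟩ := hfac K₁ s₁ hK₁ hne₁ hs₁ ht₁.1
    have hmaps : ∀ s ∈ treesOver st p S, K s ∈ treesOver st p S :=
      fun s hs => context_mem_treesOver hst hp hK hu ht₁ hs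
    have hiter : ∀ k, ∀ s ∈ treesOver st p S, K^[k] s ∈ treesOver st p S := by
      intro k s hs
      induction k with
      | zero => exact hs
      | succ k ih => rw [Function.iterate_succ_apply']; exact hmaps _ ih
    obtain ⟨e, he⟩ := hK.leaves_eq
    have hepos : 0 < e := leaves_pos_of_context hA hK hne
      (fun k => (hiter k _ (treesOver_of_context hK ht₁ hu)).1) he
    let f : treesOver st p (S.erase p) × ℕ → treesOver st p S :=
      fun q => ⟨K^[q.2] q.1.1, hiter _ _ (treesOver_mono (Finset.erase_subset _ _) q.1.2)⟩
    have aux : ∀ (s t : treesOver st p (S.erase p)) (k l : ℕ), k ≤ l →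
        K^[k] s.1 = K^[l] t.1 → s = t ∧ k = l := by
      intro s t k l hkl h
      obtain ⟨m, rfl⟩ := Nat.exists_eq_add_of_le hkl
      rw [Function.iterate_add_apply] at h
      have h1 := hK.injective.iterate k h
      rcases eq_or_ne m 0 with rfl | hm
      · exact ⟨Subtype.ext h1, rfl⟩
      -- For `m ≠ 0`, the tree `t` of state `p` would be a proper subtree of `s`.
      · have := s.2.2 _ _ (hK.iterate m) (hK.iterate_ne_id hne hm) h1
        rw [t.2.1] at this
        simp at this
    have hinj : Function.Injective f := by
      rintro ⟨s, k⟩ ⟨t, l⟩ h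
      have h1 : K^[k] s.1 = K^[l] t.1 := congr_arg Subtype.val h
      rcases le_total k l with hkl | hkl
      · obtain ⟨rfl, rfl⟩ := aux s t k l hkl h1; rfl
      · obtain ⟨rfl, rfl⟩ := aux t s l k hkl h1.symm; rfl
    have hsurj : Function.Surjective f := by
      -- As long as some proper subtree has state `p`, one copy of `K` can be peeled off at the
      -- root.
      have key : ∀ n, ∀ t : treesOver st p S, t.1.vertices = n → ∃ q, f q = t := by
        intro n
        induction n using Nat.strong_induction_on with
        | _ n ihn =>
        intro t htn
        by_cases ht : t.1 ∈ treesOver st p (S.erase p)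
        · exact ⟨(⟨t.1, ht⟩, 0), rfl⟩
        · have : ∃ L s, IsContext L ∧ L ≠ id ∧ t.1 = L s ∧ st s = p := by
            by_contra! hcon
            exact ht ⟨t.2.1, fun L s hL hLne h => Finset.mem_erase.2
              ⟨hcon L s hL hLne h, t.2.2 L s hL hLne h⟩⟩
          obtain ⟨L, s, hL, hLne, hts, hs⟩ := this
          obtain ⟨M, hM, rfl, hMs⟩ := hfac L s hL hLne hs (hts ▸ t.2.1)
          have h1 : t.1 = K (M s) := hts
          have h2 : M s ∈ treesOver st p S := treesOver_of_context hK (h1 ▸ t.2) hMs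
          obtain ⟨⟨q, k⟩, hq⟩ := ihn _ (by rw [← htn, h1]; exact hK.vertices_lt hne _)
            ⟨M s, h2⟩ rfl
          refine ⟨(q, k + 1), Subtype.ext ?_⟩
          have h3 : K^[k] q.1 = M s := congr_arg Subtype.val hq
          change K^[k + 1] q.1 = t.1
          rw [Function.iterate_succ_apply', h3, h1]
      exact fun t => key _ t rfl
    refine (ih.prod_nat hepos).of_equiv (Equiv.ofBijective f ⟨hinj, hsurj⟩) ?_
    rintro ⟨s, k⟩
    change (K^[k] s.1).leaves = s.1.leaves + e * k
    induction k with
    | zero => simp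
    | succ k ih => rw [Function.iterate_succ_apply', he, ih]; ring
  · have : treesOver st p S = treesOver st p (S.erase p) := by
      refine Set.Subset.antisymm (fun t ht => ⟨ht.1, fun K s hK hne h => ?_⟩)
        (treesOver_mono (Finset.erase_subset _ _))
      refine Finset.mem_erase.2 ⟨fun hs => hex ⟨K, s, hK, hne, hs, h ▸ ht⟩, ht.2 K s hK hne h⟩
    rw [this]
    exact ih

variable (st) in
/-- The root label of a tree and the states of its branches. -/
def rootState : PTree ar → Option (Σ x, (Fin (ar x) → Q))
  | leaf => none
  | node x c => some ⟨x, fun j => st (c j)⟩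

theorem branch_mem_treesOver {p : Q} {S : Finset Q} {x : Υ} {c : Fin (ar x) → PTree ar}
    (h : node x c ∈ treesOver st p S) (j : Fin (ar x)) :
    st (c j) ∈ S ∧ c j ∈ treesOver st (st (c j)) S := by
  have hc : node x c = (fun t => node x (Function.update c j t)) (c j) := by
    simp only [Function.update_eq_self]
  refine ⟨h.2 _ _ (isContext_branch x c j) (fun e => ?_) hc,
    treesOver_of_context (isContext_branch x c j) (hc ▸ h) rfl⟩
  exact absurd (congr_fun e leaf) (by simp)

-- For a fixed root label and fixed states of the branches, the trees form a product of the sets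
-- `treesOver st q S` with `q ∈ S`, or consist of the leaf alone, or do not exist. The state `p` of
-- the root need not belong to `S`.
include hst in
theorem isPolyParam_treesOver [Finite Υ] [Finite Q] {p : Q} {S : Finset Q}
    (ih : ∀ q ∈ S, IsPolyParam fun t : treesOver st q S => t.1.leaves) :
    IsPolyParam fun t : treesOver st p S => t.1.leaves := by
  refine IsPolyParam.of_fibers (fun t => rootState st t.1) fun y => ?_
  by_cases hne : Nonempty {t : treesOver st p S // rootState st t.1 = y}
  swap
  · have := not_nonempty_iff.1 hne
    exact .of_subsingleton _
  obtain ⟨⟨⟨t₀, ht₀⟩, hy⟩⟩ := hne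
  cases t₀ with
  | leaf =>
    have : Subsingleton {t : treesOver st p S // rootState st t.1 = y} := by
      refine ⟨?_⟩
      subst hy
      rintro ⟨⟨_ | ⟨x, c⟩, h⟩, h'⟩ ⟨⟨_ | ⟨x, c⟩, h1⟩, h1'⟩
      · rfl
      all_goals simp [rootState] at h' h1'
    exact .of_subsingleton _
  | node x c₀ =>
    have hS : ∀ j, st (c₀ j) ∈ S := fun j => (branch_mem_treesOver ht₀ j).1
    have hmem : ∀ c : ∀ j, treesOver st (st (c₀ j)) S,
        node x (fun j => (c j).1) ∈ treesOver st p S := by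
      intro c
      refine ⟨(hst x _ c₀ fun j => (c j).2.1).trans ht₀.1, fun K s hK hKne h => ?_⟩
      cases hK with
      | hole => exact absurd rfl hKne
      | branch x' c' j K hK =>
        simp only [PTree.node.injEq] at h
        obtain ⟨rfl, h⟩ := h
        have h1 : (c j).1 = K s := by simpa using congr_fun (eq_of_heq h) j
        by_cases hid : K = id
        · subst hid
          rw [← show (c j).1 = s from h1, (c j).2.1]
          exact hS j
        · exact (c j).2.2 K s hK hid h1
    let f : (∀ j, treesOver st (st (c₀ j)) S) →
        {t : treesOver st p S // rootState st t.1 = y} :=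
      fun c => ⟨⟨node x fun j => (c j).1, hmem c⟩, by
        subst hy
        simp only [rootState]
        congr 2
        funext j
        exact (c j).2.1⟩
    have hf : Function.Bijective f := by
      constructor
      · intro c c' h
        have h1 : node x (fun j => (c j).1) = node x fun j => (c' j).1 :=
          congr_arg (fun t => t.1.1) h
        simp only [PTree.node.injEq, heq_eq_eq, true_and] at h1
        funext j
        exact Subtype.ext (congr_fun h1 j)
      · rintro ⟨⟨t, ht⟩, hty⟩
        cases t with
        | leaf => subst hy; simp [rootState] at hty
        | node x' c =>
          subst hy
          simp only [rootState, Option.some.injEq, Sigma.mk.injEq] at hty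
          obtain ⟨rfl, h⟩ := hty
          have h1 := congr_fun (eq_of_heq h)
          exact ⟨fun j => ⟨c j, h1 j ▸ (branch_mem_treesOver ht j).2⟩, rfl⟩
    exact (IsPolyParam.pi fun j => ih _ (hS j)).of_equiv (Equiv.ofBijective f hf) fun c => rfl

include har hst in
/-- The weight `leaves` is polynomially parametrized on a recognizable hereditary set of trees of
small growth. -/
theorem SmallGrowth.isPolyParam [Finite Υ] [Finite Q] {N : Set (PTree ar)} (hN : SmallGrowth N)
    (hNst : ∀ s t, st s = st t → s ∈ N → t ∈ N)
    (hNsub : ∀ x (c : Fin (ar x) → PTree ar) j, node x c ∈ N → c j ∈ N) :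
    IsPolyParam fun t : N => t.1.leaves := by
  classical
  have := Fintype.ofFinite Q
  let good : Finset Q := Finset.univ.filter fun p => ∃ t ∈ N, st t = p
  have hgood : ∀ p ∈ good, {t | st t = p} ⊆ N := by
    intro p hp t ht
    obtain ⟨s, hs, rfl⟩ := (Finset.mem_filter.1 hp).2
    exact hNst s t ht.symm hs
  -- Splitting at the root leads to branches with states `q ∈ S`; extracting the power of the
  -- context of `q` then removes `q` from the allowed states.
  have key : ∀ S : Finset Q, S ⊆ good → ∀ p,
      IsPolyParam fun t : treesOver st p S => t.1.leaves := by
    intro S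
    induction S using Finset.strongInduction with
    | H S ih =>
      intro hS p
      refine isPolyParam_treesOver hst fun q hq => ?_
      exact isPolyParam_treesOver_of_mem har hst hq (hN.mono (hgood q (hS hq)))
        (ih _ (Finset.erase_ssubset hq) ((Finset.erase_subset _ _).trans hS) q)
  have hsub : ∀ {K : PTree ar → PTree ar}, IsContext K → ∀ {t}, K t ∈ N → t ∈ N := by
    intro K hK
    induction hK with
    | hole => exact fun h => h
    | branch x c j K _ ih => exact fun h => ih (by simpa using hNsub _ _ j h)
  refine IsPolyParam.of_fibers (fun t => st t.1) fun p => ?_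
  by_cases hp : p ∈ good
  · let f : treesOver st p good ≃ {t : N // st t.1 = p} :=
      { toFun := fun t => ⟨⟨t.1, hgood p hp t.2.1⟩, t.2.1⟩
        invFun := fun t => ⟨t.1.1, t.2, fun K s hK _ h => Finset.mem_filter.2
          ⟨Finset.mem_univ _, s, hsub hK (h ▸ t.1.2), rfl⟩⟩
        left_inv := fun _ => rfl
        right_inv := fun _ => rfl }
    exact (key good subset_rfl p).of_equiv f fun _ => rfl
  · have : IsEmpty {t : N // st t.1 = p} :=
      ⟨fun t => hp (Finset.mem_filter.2 ⟨Finset.mem_univ _, t.1.1, t.1.2, t.2⟩)⟩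
    exact .of_subsingleton _

end PTree

/-! ### Counting -/

/-- The set of natural solutions of `a + ∑ j, b j * k j = n`. -/
def affineSolutions {δ : Type} [Fintype δ] (a : ℕ) (b : δ → ℕ) (n : ℕ) : Set (δ → ℕ) :=
  {k | a + ∑ j, b j * k j = n}

section Solutions

variable {δ : Type} [Fintype δ] (a : ℕ) {b : δ → ℕ} (hb : ∀ j, 0 < b j) (n : ℕ)

include hb in
theorem le_of_mem_affineSolutions {k : δ → ℕ} (hk : k ∈ affineSolutions a b n) (j : δ) :
    k j ≤ n := by
  have h1 : b j * k j ≤ ∑ j, b j * k j :=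
    Finset.single_le_sum (f := fun j => b j * k j) (fun _ _ => Nat.zero_le _) (Finset.mem_univ j)
  have h2 : k j ≤ b j * k j := Nat.le_mul_of_pos_left _ (hb j)
  have : a + ∑ j, b j * k j = n := hk
  omega

include hb in
theorem affineSolutions_finite : (affineSolutions a b n).Finite :=
  (Set.Finite.pi' fun _ => Set.finite_Iic n).subset fun _ hk j =>
    le_of_mem_affineSolutions a hb n hk j

-- All coordinates are at most `n`, and all but one of them determine the last. For empty `δ` the
-- truncated exponent is `0`, matching the at most one solution.
include hb in
theorem ncard_affineSolutions_le :
    (affineSolutions a b n).ncard ≤ (n + 1) ^ (Fintype.card δ - 1) := by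
  classical
  rcases isEmpty_or_nonempty δ with h | ⟨⟨i⟩⟩
  · have : Fintype.card δ - 1 = 0 := by rw [Fintype.card_eq_zero]
    rw [this, pow_zero]
    exact Set.ncard_le_one_of_subsingleton _
  · have := (affineSolutions_finite a hb n).to_subtype
    let f : affineSolutions a b n → ({j // j ≠ i} → Fin (n + 1)) :=
      fun k j => ⟨k.1 j, Nat.lt_succ_of_le (le_of_mem_affineSolutions a hb n k.2 j)⟩
    have hf : Function.Injective f := by
      rintro ⟨k, hk⟩ ⟨l, hl⟩ h
      have h1 : ∀ j, j ≠ i → k j = l j := fun j hj =>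
        congr_arg Fin.val (congr_fun h ⟨j, hj⟩)
      have h2 : a + ∑ j, b j * k j = a + ∑ j, b j * l j := Eq.trans hk (Eq.symm hl)
      rw [← Finset.add_sum_erase _ _ (Finset.mem_univ i),
        ← Finset.add_sum_erase (a := i) _ (fun j => b j * l j) (Finset.mem_univ i),
        Finset.sum_congr rfl fun j hj => by rw [h1 j (Finset.ne_of_mem_erase hj)]] at h2
      have h3 : b i * k i = b i * l i := by omega
      refine Subtype.ext (funext fun j => ?_)
      by_cases hj : j = i
      · subst hj; exact Nat.eq_of_mul_eq_mul_left (hb j) h3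
      · exact h1 j hj
    have := Nat.card_le_card_of_injective f hf
    rw [Nat.card_coe_set_eq] at this
    simpa [Fintype.card_subtype_compl] using this

-- Setting `k j = (∏ l ≠ j, b l) * g j` turns the equation into `∑ g j = m`. All but one of the `g
-- j` may be any numbers up to `m / card δ`, and the last one makes up the sum.
include hb in
theorem le_ncard_affineSolutions [Nonempty δ] (m : ℕ) :
    (m / Fintype.card δ + 1) ^ (Fintype.card δ - 1)
      ≤ (affineSolutions a b (a + (∏ j, b j) * m)).ncard := by
  classical
  obtain ⟨i⟩ := ‹Nonempty δ›
  set n := a + (∏ j, b j) * m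
  set r := m / Fintype.card δ
  have := (affineSolutions_finite a hb n).to_subtype
  let g : ({j // j ≠ i} → Fin (r + 1)) → δ → ℕ := fun k j =>
    if h : j = i then m - ∑ j, (k j : ℕ) else k ⟨j, h⟩
  have hg : ∀ k, ∑ j, g k j = m := by
    intro k
    rw [← Finset.add_sum_erase _ _ (Finset.mem_univ i)]
    have h1 : ∑ j ∈ Finset.univ.erase i, g k j = ∑ j, (k j : ℕ) := by
      rw [Finset.sum_subtype (p := fun j => j ≠ i) (Finset.univ.erase i) (by simp)]
      refine Finset.sum_congr rfl fun j _ => ?_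
      simp [g, j.2]
    have h2 : ∑ j, (k j : ℕ) ≤ m := by
      calc ∑ j, (k j : ℕ) ≤ ∑ _j : {j // j ≠ i}, r :=
            Finset.sum_le_sum fun j _ => Nat.le_of_lt_succ (k j).2
        _ = Fintype.card {j // j ≠ i} * r := by simp
        _ ≤ Fintype.card δ * r := Nat.mul_le_mul_right _ (Fintype.card_subtype_le _)
        _ ≤ m := Nat.mul_div_le _ _
    rw [h1]
    simp only [g, dif_pos]
    omega
  let f : ({j // j ≠ i} → Fin (r + 1)) → affineSolutions a b n := fun k =>
    ⟨fun j => (∏ l ∈ Finset.univ.erase j, b l) * g k j, by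
      change a + _ = a + _
      congr 1
      rw [← hg k, Finset.mul_sum]
      refine Finset.sum_congr rfl fun j _ => ?_
      rw [← mul_assoc, Finset.mul_prod_erase _ _ (Finset.mem_univ j)]⟩
  have hf : Function.Injective f := by
    intro k l h
    funext j
    have h1 := congr_fun (congr_arg Subtype.val h) j.1
    have h2 := Nat.eq_of_mul_eq_mul_left (Finset.prod_pos fun l _ => hb l) h1
    simp only [g, dif_neg j.2] at h2
    exact Fin.ext h2
  have := Nat.card_le_card_of_injective f hf
  rw [Nat.card_coe_set_eq] at this
  simpa [Fintype.card_subtype_compl] using this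

end Solutions

/-! ### Rationality -/

theorem IsRationalSeries.add {f g : PowerSeries ℚ} (hf : IsRationalSeries f)
    (hg : IsRationalSeries g) : IsRationalSeries (f + g) := by
  obtain ⟨p, q, hq, h⟩ := hf
  obtain ⟨p', q', hq', h'⟩ := hg
  refine ⟨q' * p + q * p', q * q', mul_ne_zero hq hq', ?_⟩
  rw [Polynomial.coe_mul, Polynomial.coe_add, Polynomial.coe_mul, Polynomial.coe_mul, ← h, ← h']
  ring

theorem isRationalSeries_coe (p : ℚ[X]) : IsRationalSeries p :=
  ⟨p, 1, one_ne_zero, by rw [Polynomial.coe_one, one_mul]⟩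

theorem IsRationalSeries.sum {ι : Type*} (s : Finset ι) {f : ι → PowerSeries ℚ}
    (h : ∀ i ∈ s, IsRationalSeries (f i)) : IsRationalSeries (∑ i ∈ s, f i) := by
  classical
  induction s using Finset.induction_on with
  | empty => simpa using isRationalSeries_coe 0
  | insert i s hi ih =>
    rw [Finset.sum_insert hi]
    exact (h i (Finset.mem_insert_self _ _)).add
      (ih fun j hj => h j (Finset.mem_insert_of_mem hj))

theorem IsRationalSeries.of_mul {f : PowerSeries ℚ} {q : ℚ[X]} (hq : q ≠ 0)
    (h : IsRationalSeries ((q : PowerSeries ℚ) * f)) : IsRationalSeries f := by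
  obtain ⟨p, r, hr, h⟩ := h
  exact ⟨p, r * q, mul_ne_zero hr hq, by rw [Polynomial.coe_mul, mul_assoc, h]⟩

theorem one_sub_X_pow_ne_zero {c : ℕ} (hc : 0 < c) : (1 - X ^ c : ℚ[X]) ≠ 0 := by
  intro h
  have := congr_arg (Polynomial.eval 0) h
  simp [hc.ne'] at this

/-- The recursion for the number of solutions in the first unknown. -/
theorem ncard_affineSolutions_succ (a : ℕ) {d : ℕ} {b : Fin (d + 1) → ℕ} (hb : ∀ j, 0 < b j)
    (n : ℕ) : (affineSolutions a b n).ncard =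
      (affineSolutions a (fun j : Fin d => b j.succ) n).ncard +
        if b 0 ≤ n then (affineSolutions a b (n - b 0)).ncard else 0 := by
  let f : (Fin d → ℕ) → Fin (d + 1) → ℕ := fun k => Fin.cons 0 k
  let g : (Fin (d + 1) → ℕ) → Fin (d + 1) → ℕ := fun k => Function.update k 0 (k 0 + 1)
  -- Solutions with `k 0 = 0` and with `k 0 > 0`; the condition `b 0 ≤ n` guards the truncated
  -- subtraction.
  have h1 : affineSolutions a b n = f '' (affineSolutions a (fun j : Fin d => b j.succ) n) ∪
      g '' {k ∈ affineSolutions a b (n - b 0) | b 0 ≤ n} := by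
    ext k
    simp only [affineSolutions, Set.mem_union, Set.mem_image, Set.mem_ofPred_eq]
    constructor
    · intro hk
      rw [Fin.sum_univ_succ] at hk
      rcases Nat.eq_zero_or_pos (k 0) with h0 | h0
      · refine .inl ⟨fun j => k j.succ, by simpa [h0] using hk, ?_⟩
        change Fin.cons 0 (Fin.tail k) = k
        rw [← h0]
        exact Fin.cons_self_tail k
      · have h2 : b 0 * k 0 = b 0 * (k 0 - 1) + b 0 := by
          obtain ⟨m, hm⟩ := Nat.exists_eq_succ_of_ne_zero h0.ne'
          rw [hm]; simp [Nat.mul_succ]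
        refine .inr ⟨Function.update k 0 (k 0 - 1), ⟨?_, by omega⟩, ?_⟩
        · rw [Fin.sum_univ_succ]
          simp only [Function.update_self, ne_eq, Fin.succ_ne_zero, not_false_eq_true,
            Function.update_of_ne]
          omega
        · simp only [g, Function.update_self, Function.update_idem]
          rw [Nat.sub_add_cancel h0, Function.update_eq_self]
    · rintro (⟨k, hk, rfl⟩ | ⟨k, ⟨hk, hn⟩, rfl⟩)
      · rw [Fin.sum_univ_succ]
        simpa [f] using hk
      · rw [Fin.sum_univ_succ] at hk ⊢
        simp only [g, Function.update_self, ne_eq, Fin.succ_ne_zero, not_false_eq_true,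
            Function.update_of_ne, Nat.mul_add]
        omega
  have hf : Function.Injective f := fun k l h => by
    funext j
    simpa [f] using congr_fun h j.succ
  have hg : Function.Injective g := by
    intro k l h
    funext j
    have := congr_fun h j
    by_cases hj : j = 0
    · subst hj; simpa [g] using this
    · simpa [g, hj] using this
  have hdisj : Disjoint (f '' (affineSolutions a (fun j : Fin d => b j.succ) n))
      (g '' {k ∈ affineSolutions a b (n - b 0) | b 0 ≤ n}) := by
    rw [Set.disjoint_left]
    rintro _ ⟨k, -, rfl⟩ ⟨l, -, h⟩
    have := congr_fun h 0
    simp [f, g] at this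
  have hfin := affineSolutions_finite a hb (n - b 0)
  have hfin' := affineSolutions_finite a (fun j : Fin d => hb j.succ) n
  rw [h1, Set.ncard_union_eq hdisj (hfin'.image f) ((hfin.subset fun k hk => hk.1).image g),
    Set.ncard_image_of_injective _ hf, Set.ncard_image_of_injective _ hg]
  congr 1
  split_ifs with h <;> simp [h]

/-- By the recursion, multiplication by `1 - X ^ b 0` eliminates the first unknown; without unknowns
the series is `X ^ a`. -/
theorem isRationalSeries_affineSolutions_fin (a : ℕ) : ∀ {d : ℕ} {b : Fin d → ℕ},
    (∀ j, 0 < b j) →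
      IsRationalSeries (PowerSeries.mk fun n => ((affineSolutions a b n).ncard : ℚ)) := by
  intro d
  induction d with
  | zero =>
    intro b _
    have : (PowerSeries.mk fun n => ((affineSolutions a b n).ncard : ℚ))
        = ((X ^ a : ℚ[X]) : PowerSeries ℚ) := by
      ext n
      rw [PowerSeries.coeff_mk, Polynomial.coeff_coe, Polynomial.coeff_X_pow]
      split_ifs with h
      · have : affineSolutions a b n = Set.univ := by ext; simp [affineSolutions, h]
        rw [this, Set.ncard_univ]; simp
      · have : affineSolutions a b n = ∅ := by ext; simp [affineSolutions, Ne.symm h]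
        rw [this]; simp
    rw [this]
    exact isRationalSeries_coe _
  | succ d ih =>
    intro b hb
    refine .of_mul (one_sub_X_pow_ne_zero (hb 0)) ?_
    convert ih (b := fun j => b j.succ) (fun j => hb _) using 1
    ext n
    rw [Polynomial.coe_sub, Polynomial.coe_one, Polynomial.coe_pow, Polynomial.coe_X, sub_mul,
      one_mul, map_sub, PowerSeries.coeff_X_pow_mul', PowerSeries.coeff_mk,
      ncard_affineSolutions_succ a hb n, PowerSeries.coeff_mk]
    split_ifs <;> simp

theorem isRationalSeries_affineSolutions (a : ℕ) {δ : Type} [Fintype δ] {b : δ → ℕ}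
    (hb : ∀ j, 0 < b j) :
    IsRationalSeries (PowerSeries.mk fun n => ((affineSolutions a b n).ncard : ℚ)) := by
  let e := Fintype.equivFin δ
  convert isRationalSeries_affineSolutions_fin a (b := b ∘ e.symm) fun j => hb _ using 4 with n
  refine Set.ncard_congr (fun k _ => k ∘ e.symm) ?_ ?_ ?_
  · intro k hk
    have h1 := Equiv.sum_comp e.symm fun j => b j * k j
    change a + _ = n
    rw [← show a + ∑ j, b j * k j = n from hk, ← h1]
    rfl
  · intro k l _ _ h
    exact e.symm.surjective.injective_comp_right h
  · intro k hk
    refine ⟨k ∘ e, ?_, by funext j; simp⟩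
    have h1 := Equiv.sum_comp e.symm fun j => b j * k (e j)
    change a + _ = n
    rw [← show a + ∑ j, (b ∘ e.symm) j * k j = n from hk, Function.comp_def, ← h1]
    simp

/-- The counting function of a polynomially parametrized weight. -/
theorem IsPolyParam.card_fiber {X : Type} {w : X → ℕ} (h : IsPolyParam w) :
    ∃ (ι : Type) (_ : Fintype ι) (δ : ι → Type) (_ : ∀ i, Fintype (δ i)) (a : ι → ℕ)
      (b : ∀ i, δ i → ℕ), (∀ i j, 0 < b i j) ∧
        ∀ n, Nat.card {x // w x = n} = ∑ i, (affineSolutions (a i) (b i) n).ncard := by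
  obtain ⟨ι, hι, δ, hδ, a, b, e, hb, he⟩ := h
  have := Fintype.ofFinite ι
  refine ⟨ι, this, δ, hδ, a, b, hb, fun n => ?_⟩
  have (i : ι) : Finite (affineSolutions (a i) (b i) n) :=
    (affineSolutions_finite (a i) (hb i) n).to_subtype
  let f : (Σ i, affineSolutions (a i) (b i) n) → {x // w x = n} :=
    fun y => ⟨e ⟨y.1, y.2.1⟩, (he _ _).trans y.2.2⟩
  have hf : Function.Bijective f := by
    constructor
    · rintro ⟨i, k, hk⟩ ⟨j, l, hl⟩ h
      have h1 := e.injective (congr_arg Subtype.val h)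
      simp only [Sigma.mk.injEq] at h1
      obtain ⟨rfl, h1⟩ := h1
      obtain rfl := eq_of_heq h1
      rfl
    · rintro ⟨x, hx⟩
      obtain ⟨⟨i, k⟩, rfl⟩ := e.surjective x
      exact ⟨⟨i, k, (he i k).symm.trans hx⟩, rfl⟩
  rw [← Nat.card_congr (Equiv.ofBijective f hf), Nat.card_sigma]
  simp only [Nat.card_coe_set_eq]

/-! ### Growth -/

theorem affineSolutions_growth {ι : Type} [Fintype ι] {δ : ι → Type} [∀ i, Fintype (δ i)]
    (a : ι → ℕ) (b : ∀ i, δ i → ℕ) (hb : ∀ i j, 0 < b i j) {f : ℕ → ℕ}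
    (hf : ∀ n, f n = ∑ i, (affineSolutions (a i) (b i) n).ncard) :
    (∃ N₀ : ℕ, ∀ n, N₀ ≤ n → f n = 0) ∨ ∃ d : ℕ, HasGrowth (fun n => (f n : ℝ)) d := by
  by_cases hne : ∃ i, Nonempty (δ i)
  swap
  · left
    refine ⟨∑ i, a i + 1, fun n hn => ?_⟩
    rw [hf]
    refine Finset.sum_eq_zero fun i _ => ?_
    have : IsEmpty (δ i) := not_nonempty_iff.1 fun h => hne ⟨i, h⟩
    have h1 : a i ≤ ∑ i, a i := Finset.single_le_sum (fun _ _ => Nat.zero_le _) (Finset.mem_univ i)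
    have h2 : affineSolutions (a i) (b i) n = ∅ := by
      ext k
      simp only [affineSolutions, Finset.univ_eq_empty, Finset.sum_empty, add_zero,
        Set.mem_ofPred_eq, Set.mem_empty_iff_false, iff_false]
      omega
    rw [h2, Set.ncard_empty]
  right
  obtain ⟨i₁, hi₁⟩ := hne
  obtain ⟨i, -, hi⟩ := Finset.exists_max_image Finset.univ (fun i => Fintype.card (δ i))
    ⟨i₁, Finset.mem_univ _⟩
  have hpos : 0 < Fintype.card (δ i) := Fintype.card_pos.trans_le (hi i₁ (Finset.mem_univ _))
  have : Nonempty (δ i) := Fintype.card_pos_iff.1 hpos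
  set D := Fintype.card (δ i)
  refine ⟨D - 1, ⟨Fintype.card ι * 2 ^ (D - 1), ?_, fun n hn => ?_⟩, ?_⟩
  · have : 0 < Fintype.card ι := Fintype.card_pos_iff.2 ⟨i⟩
    positivity
  · have h1 : f n ≤ Fintype.card ι * (n + 1) ^ (D - 1) := by
      rw [hf, ← smul_eq_mul, ← Finset.card_univ]
      refine Finset.sum_le_card_nsmul _ _ _ fun j hj => ?_
      refine (ncard_affineSolutions_le (a j) (hb j) n).trans ?_
      exact Nat.pow_le_pow_right (Nat.succ_pos n) (Nat.sub_le_sub_right (hi j hj) 1)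
    calc (f n : ℝ) ≤ Fintype.card ι * ((n : ℝ) + 1) ^ (D - 1) := by exact_mod_cast h1
      _ ≤ Fintype.card ι * (2 * (n : ℝ)) ^ (D - 1) := by
        have : (1 : ℝ) ≤ n := by exact_mod_cast hn
        gcongr
        linarith
      _ = Fintype.card ι * 2 ^ (D - 1) * (n : ℝ) ^ (D - 1) := by rw [mul_pow, mul_assoc]
  · set B := ∏ j, b i j with hB
    have hBpos : 0 < B := Finset.prod_pos fun j _ => hb i j
    -- The lower bound is available at `n = a i + B * m`. The `m` below puts `n` strictly above `N`
    -- and at most `N + B`, hence the window `B + 1`. From `N ≥ 2 * a i` follows `n ≤ 2 * B * m`, so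
    -- `m / D + 1` is at least `n / (2 * B * D)`.
    refine ⟨(1 / (2 * B * D : ℝ)) ^ (D - 1), by positivity, B + 1, 2 * a i, fun N hN => ?_⟩
    set m := (N - a i) / B + 1
    have h1 : N - a i < B * m := Nat.lt_mul_div_succ _ hBpos
    have h2 : B * m ≤ N - a i + B := by
      rw [Nat.mul_add, mul_one]
      exact Nat.add_le_add_right (Nat.mul_div_le _ _) _
    refine ⟨a i + B * m, by omega, by omega, ?_⟩
    have h3 : (m / D + 1) ^ (D - 1) ≤ f (a i + B * m) := by
      rw [hf]
      exact (le_ncard_affineSolutions (a i) (hb i) m).trans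
        (Finset.single_le_sum
          (f := fun j => (affineSolutions (a j) (b j) (a i + B * m)).ncard)
          (fun _ _ => Nat.zero_le _) (Finset.mem_univ i))
    have h4 : (m : ℝ) ≤ D * ((m / D : ℕ) + 1 : ℝ) := by
      exact_mod_cast (Nat.lt_mul_div_succ m hpos).le
    have h5 : ((a i + B * m : ℕ) : ℝ) ≤ 2 * B * m := by
      have : a i + B * m ≤ 2 * B * m := by rw [mul_assoc]; omega
      exact_mod_cast this
    rw [← mul_pow]
    refine le_trans ?_ (show (((m / D : ℕ) + 1 : ℝ)) ^ (D - 1) ≤ (f (a i + B * m) : ℝ) by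
      exact_mod_cast h3)
    refine pow_le_pow_left₀ (by positivity) ?_ _
    rw [div_mul_eq_mul_div, one_mul, div_le_iff₀ (by positivity)]
    calc ((a i + B * m : ℕ) : ℝ) ≤ 2 * B * m := h5
      _ ≤ 2 * B * (D * ((m / D : ℕ) + 1 : ℝ)) := by gcongr
      _ = _ := by ring

/-! ### Dimensions as numbers of normal trees, and the conclusion. -/

/-- The dimensions of an operad with a finite Gröbner basis count the normal trees. -/
theorem NSOperad.card_normal {k : Type u} [Field k] {Υ : Type v} {ar : Υ → ℕ}
    {P : NSOperad.{u, w} k} (φ : (freeNSOperad k ar).Hom P) (o : AdmissibleOrder ar) (hφ : φ.Surjective)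
    {G : Set (Σ n, (freeNSOperad k ar).obj n)} (hG : IsGroebnerBasis φ o G)
    (n : ℕ) [FiniteDimensional k (P.obj n)] :
    {t | PTree.Normal (leadingPatterns o G) t ∧ t.leaves = n}.Finite ∧
      {t | PTree.Normal (leadingPatterns o G) t ∧ t.leaves = n}.ncard
        = Module.finrank k (P.obj n) := by
  have hN : ∀ t, PTree.Normal (leadingPatterns o G) t ↔ t ∉ leadingTrees φ o := by
    intro t
    rw [mem_leadingTrees_iff_divides φ o hG]
    simp only [PTree.Normal, not_exists, not_and]
  obtain ⟨hfin, hcard⟩ := card_not_mem_leadingTrees φ o hφ n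
  let e : {t : TreeMonomial ar n // t.1 ∉ leadingTrees φ o} ≃
      {t | PTree.Normal (leadingPatterns o G) t ∧ t.leaves = n} :=
    { toFun := fun t => ⟨t.1.1, (hN _).2 t.2, t.1.2⟩
      invFun := fun t => ⟨⟨t.1, t.2.2⟩, (hN _).1 t.2.1⟩
      left_inv := fun _ => rfl
      right_inv := fun _ => rfl }
  rw [← hcard, Nat.card_congr e, Nat.card_coe_set_eq]
  exact ⟨Set.finite_coe_iff.1 (Finite.of_equiv _ e), rfl⟩

theorem mainTheorem5 {k : Type u} [Field k] (P : NSOperad.{u, w} k)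
    (hP : P.HasFiniteGroebnerBasis)
    (hfin : ∀ n, FiniteDimensional k (P.obj n))
    (hgrowth : SubexponentialGrowth fun n => (Module.finrank k (P.obj n) : ℝ)) :
    IsRationalSeries P.genSeries ∧
      ((∃ N₀ : ℕ, ∀ n, N₀ ≤ n → Module.finrank k (P.obj n) = 0) ∨
        ∃ d : ℕ, HasGrowth (fun n => (Module.finrank k (P.obj n) : ℝ)) d) := by
  obtain ⟨Υ, hΥ, ar, har, φ, o, G, hφ, hGfin, hG⟩ := hP
  set W := leadingPatterns o G with hW
  have hWfin : W.Finite := leadingPatterns_finite o hGfin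
  let N : Set (PTree ar) := {t | PTree.Normal W t}
  have hcard : ∀ n, {t ∈ N | t.leaves = n}.Finite ∧
      {t ∈ N | t.leaves = n}.ncard = Module.finrank k (P.obj n) :=
    fun n => NSOperad.card_normal φ o hφ hG n
  have hN : PTree.SmallGrowth N := by
    refine ⟨fun n => (hcard n).1, ?_⟩
    simpa only [(hcard _).2] using hgrowth
  have := PTree.finite_state hWfin
  obtain ⟨ι, hι, δ, hδ, a, b, hb, hf⟩ := (hN.isPolyParam har (PTree.state_node_congr W)
    (fun s t h hs => (PTree.normal_iff_of_state_eq h).1 hs)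
    (fun x c j h => PTree.Normal.branch h j)).card_fiber
  have hdim : ∀ n, Module.finrank k (P.obj n) = ∑ i, (affineSolutions (a i) (b i) n).ncard := by
    intro n
    let e : {t : N // t.1.leaves = n} ≃ {t ∈ N | t.leaves = n} :=
      { toFun := fun t => ⟨t.1.1, t.1.2, t.2⟩
        invFun := fun t => ⟨⟨t.1, t.2.1⟩, t.2.2⟩
        left_inv := fun _ => rfl
        right_inv := fun _ => rfl }
    rw [← hf, Nat.card_congr e, Nat.card_coe_set_eq, (hcard n).2]
  refine ⟨?_, affineSolutions_growth a b hb hdim⟩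
  -- The generating series omits arity `0`, while the families count it; since generators have
  -- positive arity, every tree has a leaf and nothing is lost.
  have hzero : Module.finrank k (P.obj 0) = 0 := by
    rw [← (hcard 0).2, Set.ncard_eq_zero (hcard 0).1, Set.eq_empty_iff_forall_notMem]
    exact fun t ht => (PTree.leaves_pos har t).ne' ht.2
  have hseries : P.genSeries
      = ∑ i, PowerSeries.mk fun n => ((affineSolutions (a i) (b i) n).ncard : ℚ) := by
    ext n
    simp only [NSOperad.genSeries, map_sum, PowerSeries.coeff_mk]
    split_ifs with h
    · subst h
      rw [← Nat.cast_sum, ← hdim, hzero, Nat.cast_zero]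
    · rw [hdim, Nat.cast_sum]
  rw [hseries]
  exact .sum _ fun i _ => isRationalSeries_affineSolutions (a i) (hb i)
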